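/- For $n\ge 2$ let $\Sigma^n\subseteq\mathbb R^{n+1}$ be the unit sphere and $\operatorname{dist}(p,q)=\arccos\langle p,q\rangle$ its geodesic distance. For a sequence $x=(x_i)_{i\in\mathbb Z}$ in $\Sigma^n$ let $Tx$ be the Riemannian analogue of the linear cubic Lane-Riesenfeld rule, that is, $$Tx_{i}=\operatorname*{argmin}_{p\in\Sigma^n}\sum_{j\in\mathbb Z}a_{i-2j}\operatorname{dist}(p,x_j)^2,\qquad a_0=\tfrac68,\ a_{\pm1}=\tfrac12,\ a_{\pm2}=\tfrac18,\ a_m=0 \text{ for } |m|>2 .$$ There are constants $\mu\in(0,1)$ and $C>0$ such that for every $n\ge2$ and every sequence $x=(x_i)_{i\in\mathbb Z}$ in $\Sigma^n$ with $\sup_\ell\operatorname{dist}(x_\ell,x_{\ell+1})<0.6$ the following hold. 1. (Well-definedness) For all $k\ge0$ and $i\in\mathbb Z$ the function on $\Sigma^n$ that defines $T(T^{k}x)_i$ has exactly one global minimiser, so all of $Tx,T^2x,\dots$ are well defined. 2. (Contractivity) $\operatorname{dist}(T^kx_{i+1},T^kx_i)\le\mu^k\sup_\ell\operatorname{dist}(x_\ell,x_{\ell+1})$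 for all $i\in\mathbb Z$ and $k\ge0$. 3. (Displacement-safety) $\operatorname{dist}(Tx_{2i},x_i)\le C\sup_\ell\operatorname{dist}(x_\ell,x_{\ell+1})$ for all $i\in\mathbb Z$. 4. (Convergence and smoothness) There is a $C^2$ curve $F:\mathbb R\to\Sigma^n$ to which $T^kx$ converges: for every $t_0\in\mathbb R$ and every smooth coordinate chart $\varphi$ of $\Sigma^n$ around $F(t_0)$ there is $\delta>0$ such that $F([t_0-\delta,t_0+\delta])$ lies in the domain of $\varphi$, for all large $k$ so do the points $T^kx_i$ with $i=\lfloor 2^kt\rfloor$ or $i=\lfloor 2^kt\rfloor+1$ for some $t\in[t_0-\delta,t_0+\delta]$, and the piecewise linear functions $f_k$ with $f_k(i/2^k)=\varphi(T^kx_i)$ and breakpoints in $2^{-k}\mathbb Z$ converge to $\varphi\circ F$ uniformly on $[t_0-\delta,t_0+\delta]$. -/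

import Mathlib

open scoped Manifold ContDiff
open Filter

namespace SphereSubdivision

/-- The unit sphere `Σⁿ ⊆ ℝⁿ⁺¹`, with Mathlib's smooth structure. -/
abbrev Sphere (n : ℕ) : Type :=
  Metric.sphere (0 : EuclideanSpace ℝ (Fin (n + 1))) 1

/-- The geodesic distance `arccos ⟨p, q⟩` on the unit sphere. (The `dist` that Mathlib puts on
the sphere is the chordal distance of the ambient space.) -/
noncomputable def geoDist {n : ℕ} (p q : Sphere n) : ℝ :=
  Real.arccos (inner ℝ (p : EuclideanSpace ℝ (Fin (n + 1))) (q : EuclideanSpace ℝ (Fin (n + 1))))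

/-- `sup_ℓ dist (x_ℓ, x_{ℓ+1})`; the supremum of a family bounded by `π`. -/
noncomputable def maxStep {n : ℕ} (x : ℤ → Sphere n) : ℝ :=
  ⨆ l : ℤ, geoDist (x l) (x (l + 1))

/-- The function `p ↦ ∑_j a_{i-2j} dist(p, x_j)²` belonging to a finitely supported mask `a`
(so that only finitely many summands are nonzero). -/
noncomputable def energy {n : ℕ} (a : ℤ → ℝ) (x : ℤ → Sphere n) (i : ℤ) (p : Sphere n) : ℝ :=
  ∑ᶠ j : ℤ, a (i - 2 * j) * geoDist p (x j) ^ 2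

/-- `p` is a (global) minimiser of the function defining the `i`-th refined point. -/
def IsCenter {n : ℕ} (a : ℤ → ℝ) (x : ℤ → Sphere n) (i : ℤ) (p : Sphere n) : Prop :=
  ∀ q : Sphere n, energy a x i p ≤ energy a x i q

open Classical in
/-- The Riemannian analogue `T` of the linear binary subdivision rule with mask `a`:
`(T x)_i = argmin_p ∑_j a_{i-2j} dist(p, x_j)²` wherever the minimiser exists and is unique
(and the irrelevant value `x_i` elsewhere). -/
noncomputable def riemannianAnalogue {n : ℕ} (a : ℤ → ℝ) (x : ℤ → Sphere n) : ℤ → Sphere n :=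
  fun i => if h : ∃! p, IsCenter a x i p then h.choose else x i

/-- All refined sequences `T x, T² x, T³ x, …` are well defined. -/
def WellDefinedFor {n : ℕ} (a : ℤ → ℝ) (x : ℤ → Sphere n) : Prop :=
  ∀ (k : ℕ) (i : ℤ), ∃! p, IsCenter a ((riemannianAnalogue a)^[k] x) i p

/-- Contractivity condition with factor `μ` for the data `x`. -/
def ContractiveFor {n : ℕ} (a : ℤ → ℝ) (μ : ℝ) (x : ℤ → Sphere n) : Prop :=
  ∀ (i : ℤ) (k : ℕ),
    geoDist ((riemannianAnalogue a)^[k] x (i + 1)) ((riemannianAnalogue a)^[k] x i)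
      ≤ μ ^ k * maxStep x

/-- Displacement-safe condition with constant `C` for the data `x`. -/
def DisplacementSafeFor {n : ℕ} (a : ℤ → ℝ) (C : ℝ) (x : ℤ → Sphere n) : Prop :=
  ∀ i : ℤ, geoDist (riemannianAnalogue a x (2 * i)) (x i) ≤ C * maxStep x

/-- The piecewise linear function `f` with `f (i / 2ᵏ) = v i` and breakpoints in `2⁻ᵏ ℤ`. -/
noncomputable def interpolant {V : Type*} [AddCommGroup V] [Module ℝ V]
    (k : ℕ) (v : ℤ → V) (t : ℝ) : V :=
  (1 - Int.fract (2 ^ k * t)) • v ⌊2 ^ k * t⌋ + Int.fract (2 ^ k * t) • v (⌊2 ^ k * t⌋ + 1)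

/-- The sequences `y 0, y 1, y 2, …` converge to the curve `F`: `F` is continuous, and in every
smooth coordinate chart `φ` around a point `F t₀`, near `t₀` the points of `y k` used lie in the
domain of `φ` for all large `k`, and the piecewise linear interpolants `f_k` of `φ ∘ y k`, with
`f_k (i / 2ᵏ) = φ (y k i)`, converge uniformly to `φ ∘ F`. -/
def ConvergesTo {n : ℕ} (y : ℕ → ℤ → Sphere n) (F : ℝ → Sphere n) : Prop :=
  Continuous F ∧
  ∀ t₀ : ℝ, ∀ φ ∈ IsManifold.maximalAtlas (𝓡 n) ∞ (Sphere n), F t₀ ∈ φ.source →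
    ∃ δ > 0,
      (∀ᶠ k in atTop, ∀ t ∈ Set.Icc (t₀ - δ) (t₀ + δ),
        F t ∈ φ.source ∧ y k ⌊2 ^ k * t⌋ ∈ φ.source ∧ y k (⌊2 ^ k * t⌋ + 1) ∈ φ.source) ∧
      TendstoUniformlyOn (fun k => interpolant k (fun i => φ (y k i))) (fun t => φ (F t))
        atTop (Set.Icc (t₀ - δ) (t₀ + δ))

/-- The mask of the linear cubic Lane-Riesenfeld rule
`(S x)_{2i} = x_{i-1}/8 + 6 x_i/8 + x_{i+1}/8`, `(S x)_{2i+1} = x_i/2 + x_{i+1}/2`. -/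
noncomputable def cubicLaneRiesenfeldMask (m : ℤ) : ℝ :=
  if m = 0 then 6 / 8
  else if m = 1 ∨ m = -1 then 1 / 2
  else if m = 2 ∨ m = -2 then 1 / 8
  else 0

end SphereSubdivision

namespace SphereSubdivision

/-! ### The function `θ / sin θ` in terms of `cos θ` -/

/-! Well-definedness rests on one convexity fact: `arccos c ^ 2` is a convex function of `c = cos
θ`, with slope `-2 θ / sin θ`. Since `⟪p, x j⟫` is linear in `p`, the energy satisfies a tangent
inequality in the ambient space (`angleEnergy_ge`), with gradient `-2 • pull`. If `pull` at a unit
vector `q` equals `l • q`, then on unit vectors the linear term becomes `l * ‖q - p‖ ^ 2`; for `l >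
0` such a critical point is the unique global minimiser (`angleEnergy_ge_of_pull_eq_smul`). For the
odd rule the normalized midpoint is critical by symmetry. For the even rule a minimiser exists by
compactness, lies near the middle point, and is critical with `l > 0` (`even_minimizer`). It moves
by at most 0.45 of the maximal step, while the midpoint is half a step from its neighbours; hence
the factor 0.95, and the bound 0.6 persists under iteration.

Smoothness follows by comparison with the linear rule `S` in the ambient space. Up to third order
terms the refined point is the normalization of the linear mean `w`, and `1 - ‖w‖ ^ 2` is the
variance of the averaged points. The masks `(1/8, 6/8, 1/8)` and `(1/2, 1/2)` both have variance
`1/4`, so the deviations of `T x` from `S x` at `2i` and `2i + 1` share the leading term `(‖x (i+1)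
- x i‖ ^ 2 / 8) • x i` (`even_proximity`, `odd_proximity`). If `D` and `ε` bound the first and
second differences of `x`, then `T x - S x` is `O(D ^ 2)`, and its differences are `O(D ^ 3 + D ε)`.

The rule `S` shrinks first, second and third differences by 1/2, 1/4 and 1/8. The perturbations are
small enough that the first two rates survive up to a constant and the third becomes `3/16`
(`NearLinear.decay`). Therefore the points and their differences scaled by `2 ^ k` and `4 ^ k`
converge geometrically to a curve and its first two derivatives
(`NearLinear.exists_contDiff_limit`). The limit has norm one, and uniform continuity of charts on
compact balls transfers the convergence. -/

lemma mul_sinc (t : ℝ) : t * Real.sinc t = Real.sin t := by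
  rcases eq_or_ne t 0 with rfl | h
  · simp
  · rw [Real.sinc_of_ne_zero h]; field_simp

/-- Concavity of the sine puts its graph above the chord from the origin. -/
lemma sinc_antitoneOn : AntitoneOn Real.sinc (Set.Icc 0 Real.pi) := by
  rintro u ⟨hu0, -⟩ v ⟨-, hv⟩ huv
  rcases hu0.eq_or_lt with rfl | hu0
  · simpa using Real.sinc_le_one v
  have hv0 : 0 < v := hu0.trans_le huv
  rw [Real.sinc_of_ne_zero hu0.ne', Real.sinc_of_ne_zero hv0.ne', div_le_div_iff₀ hv0 hu0]
  have hm0 : (0 : ℝ) ∈ Set.Icc 0 Real.pi := ⟨le_rfl, Real.pi_pos.le⟩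
  have hmv : v ∈ Set.Icc 0 Real.pi := ⟨hv0.le, hv⟩
  have h := strictConcaveOn_sin_Icc.concaveOn.2 hm0 hmv
    (show 0 ≤ 1 - u / v by rw [sub_nonneg, div_le_one hv0]; exact huv)
    (show 0 ≤ u / v by positivity) (by ring)
  have h2 : u / v * v = u := by field_simp
  simp only [smul_eq_mul, mul_zero, Real.sin_zero, zero_add, h2] at h
  rw [div_mul_eq_mul_div, div_le_iff₀ hv0] at h
  linarith

lemma sinc_pos {t : ℝ} (h0 : 0 ≤ t) (h : t < Real.pi) : 0 < Real.sinc t := by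
  rcases h0.eq_or_lt with rfl | h0
  · simp
  · rw [Real.sinc_of_ne_zero h0.ne']
    exact div_pos (Real.sin_pos_of_pos_of_lt_pi h0 h) h0

/-- The derivative of `t ^ 2 + 2 r cos t` is `2 t (1 - r sinc t)`. As `sinc` decreases, it changes
sign from minus to plus at `a`, where the minimum is therefore attained. -/
lemma sq_sub_sq_ge_of_cos {a t : ℝ} (ha0 : 0 ≤ a) (ha : a < Real.pi) (ht0 : 0 ≤ t)
    (ht : t ≤ Real.pi) :
    a ^ 2 - 2 * (Real.sinc a)⁻¹ * (Real.cos t - Real.cos a) ≤ t ^ 2 := by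
  set r := (Real.sinc a)⁻¹ with hr
  have hs := sinc_pos ha0 ha
  have hr0 : 0 < r := inv_pos.2 hs
  have hrs : r * Real.sinc a = 1 := inv_mul_cancel₀ hs.ne'
  let f : ℝ → ℝ := fun t => t ^ 2 + 2 * r * Real.cos t
  have hd : ∀ t, HasDerivAt f (2 * t * (1 - r * Real.sinc t)) t := fun t => by
    have h := ((hasDerivAt_id t).pow 2).add ((Real.hasDerivAt_cos t).const_mul (2 * r))
    refine h.congr_deriv ?_
    have := mul_sinc t
    simp only [id]
    rw [← this]; push_cast; ring
  have hc : Continuous f := by fun_prop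
  suffices f a ≤ f t by simp only [f] at this; linarith
  rcases le_total t a with h | h
  · have : AntitoneOn f (Set.Icc 0 a) := by
      refine antitoneOn_of_deriv_nonpos (convex_Icc _ _) hc.continuousOn
        (fun x _ => (hd x).differentiableAt.differentiableWithinAt) fun x hx => ?_
      rw [interior_Icc] at hx
      rw [(hd x).deriv]
      have h1 : Real.sinc a ≤ Real.sinc x :=
        sinc_antitoneOn ⟨hx.1.le, hx.2.le.trans ha.le⟩ ⟨ha0, ha.le⟩ hx.2.le
      have h2 := mul_le_mul_of_nonneg_left h1 hr0.le
      exact mul_nonpos_of_nonneg_of_nonpos (by linarith [hx.1]) (by linarith)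
    exact this ⟨ht0, h⟩ ⟨ha0, le_rfl⟩ h
  · have : MonotoneOn f (Set.Icc a Real.pi) := by
      refine monotoneOn_of_deriv_nonneg (convex_Icc _ _) hc.continuousOn
        (fun x _ => (hd x).differentiableAt.differentiableWithinAt) fun x hx => ?_
      rw [interior_Icc] at hx
      rw [(hd x).deriv]
      have h1 : Real.sinc x ≤ Real.sinc a :=
        sinc_antitoneOn ⟨ha0, ha.le⟩ ⟨ha0.trans hx.1.le, hx.2.le⟩ hx.1.le
      have h2 := mul_le_mul_of_nonneg_left h1 hr0.le
      exact mul_nonneg (by linarith [hx.1]) (by linarith)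
    exact this ⟨le_rfl, ha.le⟩ ⟨h, ht⟩ h

/-- `θ / sin θ` as a function of `s = cos θ`. -/
noncomputable def angleRatio (s : ℝ) : ℝ := (Real.sinc (Real.arccos s))⁻¹

lemma arccos_lt_pi {s : ℝ} (h : -1 < s) : Real.arccos s < Real.pi :=
  lt_of_le_of_ne (Real.arccos_le_pi s) fun h' => by
    rw [Real.arccos_eq_pi] at h'; linarith

lemma arccos_sq_ge {s t : ℝ} (hs : -1 < s) (hs' : s ≤ 1) (ht : -1 ≤ t) (ht' : t ≤ 1) :
    Real.arccos s ^ 2 - 2 * angleRatio s * (t - s) ≤ Real.arccos t ^ 2 := by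
  have h := sq_sub_sq_ge_of_cos (Real.arccos_nonneg s) (arccos_lt_pi hs)
    (Real.arccos_nonneg t) (Real.arccos_le_pi t)
  rwa [Real.cos_arccos ht ht', Real.cos_arccos hs.le hs'] at h

lemma one_le_angleRatio {s : ℝ} (hs : -1 < s) : 1 ≤ angleRatio s :=
  (one_le_inv₀ (sinc_pos (Real.arccos_nonneg s) (arccos_lt_pi hs))).2 (Real.sinc_le_one _)

lemma angleRatio_mul_sqrt {s : ℝ} (hs : -1 < s) :
    angleRatio s * √(1 - s ^ 2) = Real.arccos s := by
  rw [← Real.sin_arccos, ← mul_sinc, angleRatio]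
  have := (sinc_pos (Real.arccos_nonneg s) (arccos_lt_pi hs)).ne'
  field_simp

/-- This is `θ ≤ tan θ` in terms of the cosine. -/
lemma angleRatio_mul_le_one {s : ℝ} (h0 : 0 < s) (h1 : s ≤ 1) : angleRatio s * s ≤ 1 := by
  have hs : -1 < s := by linarith
  have hp := sinc_pos (Real.arccos_nonneg s) (arccos_lt_pi hs)
  rw [angleRatio, inv_mul_le_iff₀ hp, mul_one]
  rcases h1.eq_or_lt with rfl | h1
  · simp
  have ha : 0 < Real.arccos s := Real.arccos_pos.2 h1
  have ha' : Real.arccos s < Real.pi / 2 := Real.arccos_lt_pi_div_two.2 h0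
  have h := Real.lt_tan ha ha'
  rw [Real.tan_eq_sin_div_cos, Real.cos_arccos hs.le h1.le, lt_div_iff₀ h0] at h
  rw [Real.sinc_of_ne_zero ha.ne', le_div_iff₀ ha]
  linarith

lemma continuousAt_angleRatio {s : ℝ} (hs : -1 < s) : ContinuousAt angleRatio s :=
  ContinuousAt.inv₀ (Real.continuous_sinc.comp Real.continuous_arccos).continuousAt
    (sinc_pos (Real.arccos_nonneg s) (arccos_lt_pi hs)).ne'

/-! ### Weighted centres on the unit sphere of an inner product space -/

section Center

variable {E : Type*} [NormedAddCommGroup E] [InnerProductSpace ℝ E] {ι : Type*}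

/-- The weighted sum of the squared angles between `p` and the points `x j`. -/
noncomputable def angleEnergy (s : Finset ι) (a : ι → ℝ) (x : ι → E) (p : E) : ℝ :=
  ∑ j ∈ s, a j * Real.arccos (inner ℝ p (x j)) ^ 2

/-- Its tangential part is minus half the gradient of `angleEnergy` at `q`. -/
noncomputable def pull (s : Finset ι) (a : ι → ℝ) (x : ι → E) (q : E) : E :=
  ∑ j ∈ s, (a j * angleRatio (inner ℝ q (x j))) • x j

lemma inner_mem_Icc {p q : E} (hp : ‖p‖ = 1) (hq : ‖q‖ = 1) :
    -1 ≤ inner ℝ p q ∧ inner ℝ p q ≤ 1 := by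
  have h := abs_real_inner_le_norm p q
  rw [hp, hq, mul_one] at h
  exact abs_le.1 h

lemma norm_sub_sq_of_unit {p q : E} (hp : ‖p‖ = 1) (hq : ‖q‖ = 1) :
    ‖p - q‖ ^ 2 = 2 * (1 - inner ℝ p q) := by
  rw [norm_sub_sq_real, hp, hq]; ring

lemma inner_eq_of_unit {p q : E} (hp : ‖p‖ = 1) (hq : ‖q‖ = 1) :
    inner ℝ p q = 1 - ‖p - q‖ ^ 2 / 2 := by
  rw [norm_sub_sq_of_unit hp hq]; ring

variable {s : Finset ι} {a : ι → ℝ} {x : ι → E}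

/-- Sum of the tangent inequalities `arccos_sq_ge` at the values `⟪q, x j⟫`. The bound is global in
`p`; only `q` has to avoid the antipodes of the data. -/
lemma angleEnergy_ge (ha : ∀ j ∈ s, 0 ≤ a j) (hx : ∀ j ∈ s, ‖x j‖ = 1) {p q : E}
    (hp : ‖p‖ = 1) (hq : ‖q‖ = 1) (hqx : ∀ j ∈ s, -1 < inner ℝ q (x j)) :
    angleEnergy s a x q - 2 * inner ℝ (pull s a x q) (p - q) ≤ angleEnergy s a x p := by
  rw [angleEnergy, angleEnergy, pull, sum_inner, Finset.mul_sum, ← Finset.sum_sub_distrib]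
  refine Finset.sum_le_sum fun j hj => ?_
  have h := arccos_sq_ge (hqx j hj) (inner_mem_Icc hq (hx j hj)).2
    (inner_mem_Icc hp (hx j hj)).1 (inner_mem_Icc hp (hx j hj)).2
  have h2 := mul_le_mul_of_nonneg_left h (ha j hj)
  rw [real_inner_smul_left, inner_sub_right, real_inner_comm p, real_inner_comm q]
  refine le_trans (le_of_eq ?_) h2
  ring

/-- For unit vectors `-2 ⟪q, p - q⟫ = ‖q - p‖ ^ 2`, so the sphere constraint turns the linear term
into quadratic growth. For `l > 0` this yields global optimality and uniqueness at once. -/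
lemma angleEnergy_ge_of_pull_eq_smul (ha : ∀ j ∈ s, 0 ≤ a j) (hx : ∀ j ∈ s, ‖x j‖ = 1) {p q : E}
    (hp : ‖p‖ = 1) (hq : ‖q‖ = 1) (hqx : ∀ j ∈ s, -1 < inner ℝ q (x j)) {l : ℝ}
    (hl : pull s a x q = l • q) :
    angleEnergy s a x q + l * ‖q - p‖ ^ 2 ≤ angleEnergy s a x p := by
  refine le_trans (le_of_eq ?_) (angleEnergy_ge ha hx hp hq hqx)
  rw [hl, real_inner_smul_left, inner_sub_right, real_inner_self_eq_norm_sq, hq,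
    norm_sub_sq_of_unit hq hp]
  ring

lemma inner_tangential_eq_zero (w : E) {q : E} (hq : ‖q‖ = 1) :
    inner ℝ (w - (inner ℝ w q : ℝ) • q) q = 0 := by
  rw [inner_sub_left, real_inner_smul_left, real_inner_self_eq_norm_sq, hq]; ring

/-- Distance of a minimiser `e` from a point `q` in terms of the gradient at `q`. -/
lemma norm_sub_le_of_minimizer (ha : ∀ j ∈ s, 0 ≤ a j) (hx : ∀ j ∈ s, ‖x j‖ = 1) {e q : E}
    (he : ‖e‖ = 1) (hq : ‖q‖ = 1) (hqx : ∀ j ∈ s, -1 < inner ℝ q (x j)) {κ : ℝ}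
    (hκ : angleEnergy s a x e + κ * ‖e - q‖ ^ 2 ≤ angleEnergy s a x q) :
    (κ + inner ℝ (pull s a x q) q) * ‖e - q‖ ≤
      2 * ‖pull s a x q - (inner ℝ (pull s a x q) q : ℝ) • q‖ := by
  have h := angleEnergy_ge ha hx he hq hqx
  set W := pull s a x q
  set l : ℝ := inner ℝ W q with hl
  set g := W - l • q with hg
  -- The radial part of `W` contributes `-l ‖e - q‖ ^ 2 / 2`, which is how `l` joins the growth
  -- constant `κ`.
  have h1 : inner ℝ W (e - q) = inner ℝ g (e - q) - l * ‖e - q‖ ^ 2 / 2 := by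
    rw [hg, inner_sub_left, real_inner_smul_left, norm_sub_sq_of_unit he hq, inner_sub_right q,
      real_inner_self_eq_norm_sq, hq, real_inner_comm q e]
    ring
  have h2 := real_inner_le_norm g (e - q)
  rcases (norm_nonneg (e - q)).eq_or_lt with h0 | h0
  · rw [← h0]; simp
  · refine le_of_mul_le_mul_right ?_ h0
    nlinarith

/-- First order condition for a minimiser. -/
lemma pull_eq_smul_of_minimizer (ha : ∀ j ∈ s, 0 ≤ a j) (hx : ∀ j ∈ s, ‖x j‖ = 1) {e : E}
    (he : ‖e‖ = 1) (hex : ∀ j ∈ s, -1 < inner ℝ e (x j))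
    (hmin : ∀ q : E, ‖q‖ = 1 → angleEnergy s a x e ≤ angleEnergy s a x q) :
    pull s a x e = (inner ℝ (pull s a x e) e : ℝ) • e := by
  -- One-sided variation along the great circle through `e` with direction `v`.
  have key : ∀ v : E, ‖v‖ = 1 → inner ℝ e v = 0 → inner ℝ (pull s a x e) v ≤ 0 := by
    intro v hv hev
    let c : ℝ → E := fun t => Real.cos t • e + Real.sin t • v
    have hc : Continuous c := by fun_prop
    have hc0 : c 0 = e := by simp [c]
    have hcn : ∀ t, ‖c t‖ = 1 := fun t => by
      have : ‖c t‖ ^ 2 = 1 := by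
        rw [norm_add_sq_real, norm_smul, norm_smul, he, hv, real_inner_smul_left,
          real_inner_smul_right, hev, mul_one, mul_one, Real.norm_eq_abs, Real.norm_eq_abs,
          sq_abs, sq_abs, mul_zero, mul_zero, mul_zero, add_zero, Real.cos_sq_add_sin_sq]
      exact (pow_eq_one_iff_of_nonneg (norm_nonneg _) two_ne_zero).1 this
    have hin : ∀ j, ContinuousAt (fun t => inner ℝ (c t) (x j)) 0 := fun j => by fun_prop
    have hpos : ∀ᶠ t in nhds (0 : ℝ), ∀ j ∈ s, -1 < inner ℝ (c t) (x j) := by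
      rw [Finset.eventually_all]
      intro j hj
      exact (hin j).eventually_const_lt (by simpa only [hc0] using hex j hj)
    have hpull : ContinuousAt (fun t => pull s a x (c t)) 0 := by
      unfold pull
      refine tendsto_finsetSum _ fun j hj => ?_
      refine ContinuousAt.smul (continuousAt_const.mul ?_) continuousAt_const
      refine ContinuousAt.comp (g := angleRatio) ?_ (hin j)
      rw [hc0]
      exact continuousAt_angleRatio (hex j hj)
    have hlim : Tendsto (fun t : ℝ => (inner ℝ (pull s a x (c t))
        (Real.sin (t / 2) • e - Real.cos (t / 2) • v) : ℝ)) (nhdsWithin 0 (Set.Ioi 0))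
        (nhds (inner ℝ (pull s a x e) (-v))) := by
      have : ContinuousAt (fun t : ℝ => (inner ℝ (pull s a x (c t))
        (Real.sin (t / 2) • e - Real.cos (t / 2) • v) : ℝ)) 0 :=
        hpull.inner (by fun_prop)
      have h2 := this.tendsto
      simp only [hc0, zero_div, Real.sin_zero, Real.cos_zero, zero_smul, one_smul, zero_sub] at h2
      exact h2.mono_left nhdsWithin_le_nhds
    have hnn : 0 ≤ inner ℝ (pull s a x e) (-v) := by
      refine ge_of_tendsto hlim ?_
      filter_upwards [hpos.filter_mono nhdsWithin_le_nhds,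
        Ioo_mem_nhdsGT (Real.pi_pos : (0 : ℝ) < Real.pi)] with t ht ht2
      -- The tangent inequality is taken at the moving point `c t` towards `e`. Only continuity of
      -- `pull` is then needed, not differentiability of `arccos`, which fails at 1.
      have h1 := angleEnergy_ge ha hx he (hcn t) ht
      have h2 := hmin _ (hcn t)
      have h3 : 0 ≤ inner ℝ (pull s a x (c t)) (e - c t) := by linarith
      have h4 : e - c t =
          (2 * Real.sin (t / 2)) • (Real.sin (t / 2) • e - Real.cos (t / 2) • v) := by
        have hs : Real.sin t = 2 * Real.sin (t / 2) * Real.cos (t / 2) := by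
          rw [← Real.sin_two_mul]; congr 1; ring
        have hcs : Real.cos t = 1 - 2 * Real.sin (t / 2) ^ 2 := by
          rw [← Real.cos_two_mul_eq_one_sub]; congr 1; ring
        simp only [c, hs, hcs]
        module
      have h5 : 0 < Real.sin (t / 2) :=
        Real.sin_pos_of_pos_of_lt_pi (by linarith [ht2.1]) (by linarith [ht2.1, ht2.2])
      rw [h4, real_inner_smul_right] at h3
      exact nonneg_of_mul_nonneg_right h3 (by linarith)
    rw [inner_neg_right] at hnn
    linarith
  set W := pull s a x e
  set g := W - (inner ℝ W e : ℝ) • e with hg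
  by_contra hne
  have hg0 : g ≠ 0 := fun h => hne (sub_eq_zero.1 h)
  have hge : inner ℝ g e = 0 := inner_tangential_eq_zero W he
  have hgn : 0 < ‖g‖ := norm_pos_iff.2 hg0
  have h := key (‖g‖⁻¹ • g) (by rw [norm_smul, norm_inv, norm_norm, inv_mul_cancel₀ hgn.ne'])
    (by rw [real_inner_smul_right, real_inner_comm, hge, mul_zero])
  have h2 : inner ℝ W g = ‖g‖ ^ 2 := by
    have : W = g + (inner ℝ W e : ℝ) • e := by rw [hg]; abel
    calc inner ℝ W g = inner ℝ (g + (inner ℝ W e : ℝ) • e) g := by rw [← this]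
      _ = _ := by
        rw [inner_add_left, real_inner_smul_left, real_inner_comm g e, hge,
          real_inner_self_eq_norm_sq]; ring
  rw [real_inner_smul_right, h2] at h
  have : 0 < ‖g‖⁻¹ * ‖g‖ ^ 2 := by positivity
  linarith

end Center

section Center

variable {E : Type*} [NormedAddCommGroup E] [InnerProductSpace ℝ E] {ι : Type*}
variable {s : Finset ι} {a : ι → ℝ} {x : ι → E}

/-! ### Angles, chords and gradients -/

lemma norm_tangential_sq {y q : E} (hy : ‖y‖ = 1) (hq : ‖q‖ = 1) :
    ‖y - (inner ℝ y q : ℝ) • q‖ ^ 2 = 1 - inner ℝ q y ^ 2 := by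
  rw [norm_sub_sq_real, norm_smul, real_inner_smul_right, hy, hq, real_inner_comm y q,
    Real.norm_eq_abs, mul_one, sq_abs]
  ring

lemma norm_tangential {y q : E} (hy : ‖y‖ = 1) (hq : ‖q‖ = 1) :
    ‖y - (inner ℝ y q : ℝ) • q‖ = √(1 - inner ℝ q y ^ 2) := by
  rw [← norm_tangential_sq hy hq, Real.sqrt_sq (norm_nonneg _)]

lemma norm_tangential_le {y q : E} (hy : ‖y‖ = 1) (hq : ‖q‖ = 1) :
    ‖y - (inner ℝ y q : ℝ) • q‖ ≤ ‖y - q‖ := by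
  refine le_of_sq_le_sq ?_ (norm_nonneg _)
  rw [norm_tangential_sq hy hq, norm_sub_sq_of_unit hy hq, real_inner_comm q y]
  nlinarith [sq_nonneg (1 - inner ℝ q y : ℝ)]

lemma tangential_pull (q : E) :
    pull s a x q - (inner ℝ (pull s a x q) q : ℝ) • q =
      ∑ j ∈ s, (a j * angleRatio (inner ℝ q (x j))) • (x j - (inner ℝ (x j) q : ℝ) • q) := by
  simp only [pull, sum_inner, Finset.sum_smul, ← Finset.sum_sub_distrib, smul_sub, smul_smul,
    real_inner_smul_left]

/-- Each data point pulls tangentially with a force of length exactly its angle, by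
`angleRatio_mul_sqrt`. -/
lemma norm_tangential_pull_le (ha : ∀ j ∈ s, 0 ≤ a j) (hx : ∀ j ∈ s, ‖x j‖ = 1) {q : E}
    (hq : ‖q‖ = 1) (hqx : ∀ j ∈ s, -1 < inner ℝ q (x j)) :
    ‖pull s a x q - (inner ℝ (pull s a x q) q : ℝ) • q‖ ≤
      ∑ j ∈ s, a j * Real.arccos (inner ℝ q (x j)) := by
  rw [tangential_pull]
  refine (norm_sum_le _ _).trans (Finset.sum_le_sum fun j hj => ?_)
  have h1 := one_le_angleRatio (hqx j hj)
  rw [norm_smul, norm_tangential (hx j hj) hq, Real.norm_eq_abs,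
    abs_of_nonneg (mul_nonneg (ha j hj) (by linarith)), mul_assoc,
    angleRatio_mul_sqrt (hqx j hj)]

lemma inner_pull_self_ge (ha : ∀ j ∈ s, 0 ≤ a j) {q : E} (hqx : ∀ j ∈ s, 0 ≤ inner ℝ q (x j)) :
    ∑ j ∈ s, a j * inner ℝ q (x j) ≤ inner ℝ (pull s a x q) q := by
  rw [pull, sum_inner]
  refine Finset.sum_le_sum fun j hj => ?_
  rw [real_inner_smul_left, real_inner_comm q (x j), mul_assoc]
  refine mul_le_mul_of_nonneg_left ?_ (ha j hj)
  exact le_mul_of_one_le_left (hqx j hj) (one_le_angleRatio (by linarith [hqx j hj]))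

lemma norm_sub_le_arccos {p q : E} (hp : ‖p‖ = 1) (hq : ‖q‖ = 1) :
    ‖p - q‖ ≤ Real.arccos (inner ℝ p q) := by
  refine le_of_sq_le_sq ?_ (Real.arccos_nonneg _)
  have h := Real.one_sub_sq_div_two_le_cos (x := Real.arccos (inner ℝ p q))
  rw [Real.cos_arccos (inner_mem_Icc hp hq).1 (inner_mem_Icc hp hq).2] at h
  rw [norm_sub_sq_of_unit hp hq]
  linarith

/-- The chord is `2 sin (t / 2)`, so Jordan's inequality applies. -/
lemma arccos_le_norm_sub {p q : E} (hp : ‖p‖ = 1) (hq : ‖q‖ = 1) :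
    Real.arccos (inner ℝ p q) ≤ Real.pi / 2 * ‖p - q‖ := by
  set t := Real.arccos (inner ℝ p q) with ht
  have ht0 : 0 ≤ t := Real.arccos_nonneg _
  have htp : t ≤ Real.pi := Real.arccos_le_pi _
  have h1 := Real.mul_le_sin (x := t / 2) (by linarith) (by linarith)
  have h2 : ‖p - q‖ ^ 2 = (2 * Real.sin (t / 2)) ^ 2 := by
    rw [norm_sub_sq_of_unit hp hq, ← Real.cos_arccos (inner_mem_Icc hp hq).1
      (inner_mem_Icc hp hq).2, ← ht]
    have : Real.cos t = 1 - 2 * Real.sin (t / 2) ^ 2 := by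
      rw [← Real.cos_two_mul_eq_one_sub]; congr 1; ring
    rw [this]; ring
  have h3 : 0 ≤ Real.sin (t / 2) :=
    Real.sin_nonneg_of_nonneg_of_le_pi (by linarith) (by linarith)
  have h4 : ‖p - q‖ = 2 * Real.sin (t / 2) :=
    (sq_eq_sq₀ (norm_nonneg _) (by linarith)).1 h2
  rw [h4]
  have h5 := mul_le_mul_of_nonneg_left h1 Real.pi_pos.le
  have h6 : Real.pi * (2 / Real.pi * (t / 2)) = t := by
    have := Real.pi_pos.ne'
    field_simp
  linarith

lemma norm_add_sq_of_unit {p q : E} (hp : ‖p‖ = 1) (hq : ‖q‖ = 1) :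
    ‖p + q‖ ^ 2 = 2 * (1 + inner ℝ p q) := by
  rw [norm_add_sq_real, hp, hq]; ring

/-! ### Three points with weights `1/8, 6/8, 1/8` -/

/-- The weights of the even rule. -/
noncomputable def evenWeight : Fin 3 → ℝ := ![1 / 8, 6 / 8, 1 / 8]

lemma evenWeight_nonneg : ∀ j ∈ Finset.univ, 0 ≤ evenWeight j := by
  intro j _
  fin_cases j <;> norm_num [evenWeight]

lemma norm_three {F : Type*} [NormedAddCommGroup F] {u v w : F} (hu : ‖u‖ = 1) (hv : ‖v‖ = 1) (hw : ‖w‖ = 1) :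
    ∀ j ∈ Finset.univ, ‖(![u, v, w] : Fin 3 → F) j‖ = 1 := by
  intro j _
  fin_cases j <;> assumption

variable {xm x0 xp e : E} {δ : ℝ}

lemma inner_ge_of_norm_sub_le {p q : E} (hp : ‖p‖ = 1) (hq : ‖q‖ = 1) {r : ℝ}
    (h : ‖p - q‖ ≤ r) : 1 - r ^ 2 / 2 ≤ inner ℝ p q := by
  rw [inner_eq_of_unit hp hq]
  have := pow_le_pow_left₀ (norm_nonneg _) h 2
  linarith

/-- A minimiser for the even rule is critical and close to the middle point. -/
lemma even_minimizer (hm : ‖xm‖ = 1) (h0 : ‖x0‖ = 1) (hp : ‖xp‖ = 1) (he : ‖e‖ = 1)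
    (hδm : Real.arccos (inner ℝ xm x0) ≤ δ) (hδp : Real.arccos (inner ℝ x0 xp) ≤ δ)
    (hδ : δ < 0.6)
    (hmin : ∀ q : E, ‖q‖ = 1 → angleEnergy Finset.univ evenWeight ![xm, x0, xp] e ≤
      angleEnergy Finset.univ evenWeight ![xm, x0, xp] q) :
    ‖e - x0‖ ≤ 0.28 * δ ∧ ∃ l > 0, ∀ p : E, ‖p‖ = 1 →
      angleEnergy Finset.univ evenWeight ![xm, x0, xp] e + l * ‖e - p‖ ^ 2 ≤
      angleEnergy Finset.univ evenWeight ![xm, x0, xp] p := by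
  have hδ0 : 0 ≤ δ := (Real.arccos_nonneg _).trans hδm
  have ha := evenWeight_nonneg
  have hx := norm_three hm h0 hp
  have cm : ‖xm - x0‖ ≤ δ := (norm_sub_le_arccos hm h0).trans hδm
  have cp : ‖x0 - xp‖ ≤ δ := (norm_sub_le_arccos h0 hp).trans hδp
  have im : 0.82 ≤ inner ℝ x0 xm := by
    have := inner_ge_of_norm_sub_le hm h0 cm
    rw [real_inner_comm]
    nlinarith
  have ip : 0.82 ≤ inner ℝ x0 xp := by
    have := inner_ge_of_norm_sub_le h0 hp cp
    nlinarith
  have i0 : inner ℝ x0 x0 = (1 : ℝ) := by rw [real_inner_self_eq_norm_sq, h0]; norm_num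
  have hx0 : ∀ j ∈ Finset.univ, 0 ≤ inner ℝ x0 ((![xm, x0, xp] : Fin 3 → E) j) := by
    intro j _
    fin_cases j
    · exact le_trans (by norm_num) im
    · exact i0.symm ▸ zero_le_one
    · exact le_trans (by norm_num) ip
  have hx0' : ∀ j ∈ Finset.univ, -1 < inner ℝ x0 ((![xm, x0, xp] : Fin 3 → E) j) :=
    fun j hj => by linarith [hx0 j hj]
  have hl := inner_pull_self_ge ha hx0
  have hg := norm_tangential_pull_le ha hx h0 hx0'
  -- A first, crude localisation: before criticality of `e` is known no growth at `e` is available,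
  -- whence `κ = 0`.
  have hn := norm_sub_le_of_minimizer ha hx he h0 hx0' (κ := 0) (by
    rw [zero_mul, add_zero]; exact hmin x0 h0)
  simp only [Fin.sum_univ_three, evenWeight, Matrix.cons_val_zero, Matrix.cons_val_one,
    Matrix.cons_val, i0, Real.arccos_one] at hl hg
  rw [real_inner_comm xm x0] at hg
  set W := pull Finset.univ evenWeight ![xm, x0, xp] x0
  change _ ≤ inner ℝ W x0 at hl
  change ‖W - (inner ℝ W x0 : ℝ) • x0‖ ≤ _ at hg
  have hne := norm_nonneg (e - x0)
  -- `0.955 = 6/8 + 2 * 0.82 / 8`, where `0.82 = 1 - 0.6 ^ 2 / 2`.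
  have hl' : 0.955 ≤ inner ℝ W x0 := by linarith
  have hg' : 2 * ‖W - (inner ℝ W x0 : ℝ) • x0‖ ≤ δ / 2 := by linarith
  have c0 : ‖e - x0‖ ≤ 0.524 * δ := by
    have := mul_le_mul_of_nonneg_right hl' hne
    linarith
  have cem : ‖e - xm‖ ≤ 1.524 * δ := by
    have := norm_sub_le_norm_sub_add_norm_sub e x0 xm
    rw [norm_sub_rev x0 xm] at this
    linarith
  have cep : ‖e - xp‖ ≤ 1.524 * δ := by
    have := norm_sub_le_norm_sub_add_norm_sub e x0 xp
    linarith
  have je0 : 0.95 ≤ inner ℝ e x0 := by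
    have := inner_ge_of_norm_sub_le he h0 c0
    nlinarith
  have jem : 0.58 ≤ inner ℝ e xm := by
    have := inner_ge_of_norm_sub_le he hm cem
    nlinarith
  have jep : 0.58 ≤ inner ℝ e xp := by
    have := inner_ge_of_norm_sub_le he hp cep
    nlinarith
  have hxe : ∀ j ∈ Finset.univ, 0 ≤ inner ℝ e ((![xm, x0, xp] : Fin 3 → E) j) := by
    intro j _
    fin_cases j
    · exact le_trans (by norm_num) jem
    · exact le_trans (by norm_num) je0
    · exact le_trans (by norm_num) jep
  have hxe' : ∀ j ∈ Finset.univ, -1 < inner ℝ e ((![xm, x0, xp] : Fin 3 → E) j) :=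
    fun j hj => by linarith [hxe j hj]
  have hcrit := pull_eq_smul_of_minimizer ha hx he hxe' hmin
  have hle := inner_pull_self_ge ha hxe
  set l : ℝ := inner ℝ (pull Finset.univ evenWeight ![xm, x0, xp] e) e
  simp only [Fin.sum_univ_three, evenWeight, Matrix.cons_val_zero, Matrix.cons_val_one,
    Matrix.cons_val] at hle
  have hl0 : 0.85 ≤ l := by
    change _ ≤ l at hle
    linarith
  have hmono := fun p hp' => angleEnergy_ge_of_pull_eq_smul ha hx (p := p) hp' he hxe' hcrit
  refine ⟨?_, l, by linarith, hmono⟩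
  -- Bootstrap: the quadratic growth at `e` nearly doubles the coefficient and improves 0.524 to
  -- 0.28. The crude bound would not give contraction.
  have hn2 := norm_sub_le_of_minimizer ha hx he h0 hx0' (hmono x0 h0)
  change (l + inner ℝ W x0) * _ ≤ 2 * ‖W - _‖ at hn2
  have h3 : (1.8 : ℝ) ≤ l + inner ℝ W x0 := by linarith
  have := mul_le_mul_of_nonneg_right h3 hne
  linarith

/-! ### The midpoint rule -/

/-- The weights of the odd rule. -/
noncomputable def oddWeight : Fin 2 → ℝ := ![1 / 2, 1 / 2]

lemma oddWeight_nonneg : ∀ j ∈ Finset.univ, 0 ≤ oddWeight j := by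
  intro j _
  fin_cases j <;> norm_num [oddWeight]

lemma norm_two {F : Type*} [NormedAddCommGroup F] {u v : F} (hu : ‖u‖ = 1) (hv : ‖v‖ = 1) :
    ∀ j ∈ Finset.univ, ‖(![u, v] : Fin 2 → F) j‖ = 1 := by
  intro j _
  fin_cases j <;> assumption

lemma inner_normalize_add_left {p q : E} (hp : ‖p‖ = 1) (hq : ‖q‖ = 1)
    (h : -1 < inner ℝ p q) :
    inner ℝ (‖p + q‖⁻¹ • (p + q)) p = ‖p + q‖ / 2 ∧
      inner ℝ (‖p + q‖⁻¹ • (p + q)) q = ‖p + q‖ / 2 := by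
  have h2 := norm_add_sq_of_unit hp hq
  have h3 : ‖p + q‖ ≠ 0 := fun h0 => by
    rw [h0] at h2
    linarith
  have e1 : inner ℝ p p = (1 : ℝ) := by rw [real_inner_self_eq_norm_sq, hp]; norm_num
  have e2 : inner ℝ q q = (1 : ℝ) := by rw [real_inner_self_eq_norm_sq, hq]; norm_num
  constructor
  · rw [real_inner_smul_left, inner_add_left, e1, real_inner_comm p q, inv_mul_eq_div,
      div_eq_div_iff h3 two_ne_zero]
    linarith
  · rw [real_inner_smul_left, inner_add_left, e2, inv_mul_eq_div,
      div_eq_div_iff h3 two_ne_zero]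
    linarith

lemma norm_add_pos {p q : E} (hp : ‖p‖ = 1) (hq : ‖q‖ = 1)
    (h : -1 < inner ℝ p q) : 0 < ‖p + q‖ := by
  have h2 := norm_add_sq_of_unit hp hq
  refine (norm_nonneg _).lt_of_ne fun h0 => ?_
  rw [← h0] at h2
  linarith

/-- Half-angle formula: `‖p + q‖ / 2` is the cosine of half the angle. -/
lemma arccos_norm_add_div_two {p q : E} (hp : ‖p‖ = 1) (hq : ‖q‖ = 1) :
    Real.arccos (‖p + q‖ / 2) = Real.arccos (inner ℝ p q) / 2 := by
  set t := Real.arccos (inner ℝ p q) with ht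
  have ht0 : 0 ≤ t := Real.arccos_nonneg _
  have htp : t ≤ Real.pi := Real.arccos_le_pi _
  have hc := Real.cos_half (x := t) (by linarith) htp
  rw [ht, Real.cos_arccos (inner_mem_Icc hp hq).1 (inner_mem_Icc hp hq).2, ← ht] at hc
  have : ‖p + q‖ / 2 = Real.cos (t / 2) := by
    rw [hc, eq_comm, Real.sqrt_eq_iff_eq_sq _ (by positivity), div_pow, norm_add_sq_of_unit hp hq]
    · ring
    · linarith [(inner_mem_Icc hp hq).1]
  rw [this, Real.arccos_cos (by linarith) (by linarith)]

/-- The normalized midpoint has equal inner products with `p` and `q`, so both pulls carry the same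
coefficient and add up to a positive multiple of `p + q`. -/
lemma odd_minimizer {p q : E} (hp : ‖p‖ = 1) (hq : ‖q‖ = 1) (h : -1 < inner ℝ p q) :
    ∃ l > 0, ∀ y : E, ‖y‖ = 1 →
      angleEnergy Finset.univ oddWeight ![p, q] (‖p + q‖⁻¹ • (p + q)) +
        l * ‖‖p + q‖⁻¹ • (p + q) - y‖ ^ 2 ≤
      angleEnergy Finset.univ oddWeight ![p, q] y := by
  obtain ⟨ip, iq⟩ := inner_normalize_add_left hp hq h
  have hpos := norm_add_pos hp hq h
  set m := ‖p + q‖⁻¹ • (p + q)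
  have hm : ‖m‖ = 1 := norm_smul_inv_norm (norm_pos_iff.1 hpos)
  have hx : ∀ j ∈ Finset.univ, -1 < inner ℝ m ((![p, q] : Fin 2 → E) j) := by
    intro j _
    fin_cases j
    · change -1 < inner ℝ m p
      linarith
    · change -1 < inner ℝ m q
      linarith
  have h1 := one_le_angleRatio (s := ‖p + q‖ / 2) (by linarith)
  refine ⟨1 / 2 * angleRatio (‖p + q‖ / 2) * ‖p + q‖, by positivity, fun y hy => ?_⟩
  refine angleEnergy_ge_of_pull_eq_smul oddWeight_nonneg (norm_two hp hq) hy hm hx ?_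
  simp only [pull, Fin.sum_univ_two, oddWeight, Matrix.cons_val_zero, Matrix.cons_val_one, ip, iq]
  simp only [m, smul_smul]
  rw [mul_assoc _ ‖p + q‖, mul_inv_cancel₀ hpos.ne', mul_one, smul_add]

end Center

/-! ### The refined points -/

section Sphere

variable {n : ℕ} {x : ℤ → Sphere n}

lemma norm_coe_sphere (p : Sphere n) : ‖(p : EuclideanSpace ℝ (Fin (n + 1)))‖ = 1 := by
  simp

lemma geoDist_comm (p q : Sphere n) : geoDist p q = geoDist q p := by
  rw [geoDist, geoDist, real_inner_comm]

lemma geoDist_nonneg (p q : Sphere n) : 0 ≤ geoDist p q := Real.arccos_nonneg _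

lemma geoDist_eq_angle (p q : Sphere n) :
    geoDist p q = InnerProductGeometry.angle (p : EuclideanSpace ℝ (Fin (n + 1))) q := by
  rw [geoDist, InnerProductGeometry.angle, norm_coe_sphere, norm_coe_sphere, mul_one, div_one]

lemma geoDist_triangle (p q r : Sphere n) : geoDist p r ≤ geoDist p q + geoDist q r := by
  simp only [geoDist_eq_angle]
  exact InnerProductGeometry.angle_le_angle_add_angle _ _ _

lemma geoDist_le_maxStep (x : ℤ → Sphere n) (l : ℤ) : geoDist (x l) (x (l + 1)) ≤ maxStep x :=
  le_ciSup (f := fun l : ℤ => geoDist (x l) (x (l + 1)))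
    ⟨Real.pi, by rintro _ ⟨l, rfl⟩; exact Real.arccos_le_pi _⟩ l

lemma geoDist_sub_one_le_maxStep (x : ℤ → Sphere n) (l : ℤ) :
    geoDist (x (l - 1)) (x l) ≤ maxStep x := by
  simpa using geoDist_le_maxStep x (l - 1)

lemma maxStep_nonneg (x : ℤ → Sphere n) : 0 ≤ maxStep x :=
  (geoDist_nonneg _ _).trans (geoDist_le_maxStep x 0)

/-! ### The energies as finite sums -/

lemma energy_even (x : ℤ → Sphere n) (i : ℤ) (p : Sphere n) :
    energy cubicLaneRiesenfeldMask x (2 * i) p =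
      angleEnergy Finset.univ evenWeight
        ![(x (i - 1) : EuclideanSpace ℝ (Fin (n + 1))), x i, x (i + 1)] p := by
  rw [energy, finsum_eq_sum_of_support_subset (s := {i - 1, i, i + 1})]
  · rw [Finset.sum_insert (by simp; omega), Finset.sum_insert (by simp), Finset.sum_singleton]
    simp only [angleEnergy, Fin.sum_univ_three, evenWeight, geoDist]
    have h1 : cubicLaneRiesenfeldMask (2 * i - 2 * (i - 1)) = 1 / 8 := by
      rw [show 2 * i - 2 * (i - 1) = 2 by ring]; norm_num [cubicLaneRiesenfeldMask]
    have h2 : cubicLaneRiesenfeldMask (2 * i - 2 * i) = 6 / 8 := by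
      rw [sub_self]; norm_num [cubicLaneRiesenfeldMask]
    have h3 : cubicLaneRiesenfeldMask (2 * i - 2 * (i + 1)) = 1 / 8 := by
      rw [show 2 * i - 2 * (i + 1) = -2 by ring]; norm_num [cubicLaneRiesenfeldMask]
    rw [h1, h2, h3, ← add_assoc]
    rfl
  · intro j hj
    by_contra hj'
    refine hj ?_
    simp only [Finset.coe_insert, Finset.coe_singleton, Set.mem_insert_iff,
      Set.mem_singleton_iff, not_or] at hj'
    have : cubicLaneRiesenfeldMask (2 * i - 2 * j) = 0 := by
      unfold cubicLaneRiesenfeldMask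
      rw [if_neg (by omega), if_neg (by omega), if_neg (by omega)]
    simp only [this, zero_mul]

lemma energy_odd (x : ℤ → Sphere n) (i : ℤ) (p : Sphere n) :
    energy cubicLaneRiesenfeldMask x (2 * i + 1) p =
      angleEnergy Finset.univ oddWeight
        ![(x i : EuclideanSpace ℝ (Fin (n + 1))), x (i + 1)] p := by
  rw [energy, finsum_eq_sum_of_support_subset (s := {i, i + 1})]
  · rw [Finset.sum_insert (by simp), Finset.sum_singleton]
    simp only [angleEnergy, Fin.sum_univ_two, oddWeight, geoDist]
    have h1 : cubicLaneRiesenfeldMask (2 * i + 1 - 2 * i) = 1 / 2 := by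
      rw [show 2 * i + 1 - 2 * i = 1 by ring]; norm_num [cubicLaneRiesenfeldMask]
    have h2 : cubicLaneRiesenfeldMask (2 * i + 1 - 2 * (i + 1)) = 1 / 2 := by
      rw [show 2 * i + 1 - 2 * (i + 1) = -1 by ring]; norm_num [cubicLaneRiesenfeldMask]
    rw [h1, h2]
    rfl
  · intro j hj
    by_contra hj'
    refine hj ?_
    simp only [Finset.coe_insert, Finset.coe_singleton, Set.mem_insert_iff,
      Set.mem_singleton_iff, not_or] at hj'
    have : cubicLaneRiesenfeldMask (2 * i + 1 - 2 * j) = 0 := by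
      unfold cubicLaneRiesenfeldMask
      rw [if_neg (by omega), if_neg (by omega), if_neg (by omega)]
    simp only [this, zero_mul]

/-! ### Existence and uniqueness of the refined points -/

lemma exists_isCenter_even (x : ℤ → Sphere n) (i : ℤ) :
    ∃ p, IsCenter cubicLaneRiesenfeldMask x (2 * i) p := by
  have hc : Continuous fun p : Sphere n => energy cubicLaneRiesenfeldMask x (2 * i) p := by
    simp only [energy_even, angleEnergy]
    refine continuous_finsetSum _ fun j _ => ?_
    exact continuous_const.mul ((Real.continuous_arccos.comp (by fun_prop)).pow 2)
  obtain ⟨p, -, hp⟩ := isCompact_univ.exists_isMinOn ⟨x 0, Set.mem_univ _⟩ hc.continuousOn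
  exact ⟨p, fun q => hp (Set.mem_univ q)⟩

lemma IsCenter.le_of_even {i : ℤ} {p : Sphere n}
    (hp : IsCenter cubicLaneRiesenfeldMask x (2 * i) p) :
    ∀ q : EuclideanSpace ℝ (Fin (n + 1)), ‖q‖ = 1 →
      angleEnergy Finset.univ evenWeight
        ![(x (i - 1) : EuclideanSpace ℝ (Fin (n + 1))), x i, x (i + 1)] p ≤
      angleEnergy Finset.univ evenWeight
        ![(x (i - 1) : EuclideanSpace ℝ (Fin (n + 1))), x i, x (i + 1)] q := by
  intro q hq
  have := hp ⟨q, by simpa using hq⟩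
  rwa [energy_even, energy_even] at this

lemma eq_of_mul_norm_sub_sq_le {E : Type*} [NormedAddCommGroup E] {p q : E} {l u v : ℝ}
    (hl : 0 < l) (h : u + l * ‖p - q‖ ^ 2 ≤ v) (h' : v ≤ u) : p = q := by
  have h1 : l * ‖p - q‖ ^ 2 ≤ 0 := by linarith
  have h2 : ‖p - q‖ ^ 2 ≤ 0 := nonpos_of_mul_nonpos_right h1 hl
  have h3 : ‖p - q‖ = 0 := pow_eq_zero_iff two_ne_zero |>.1 (le_antisymm h2 (sq_nonneg _))
  exact sub_eq_zero.1 (norm_eq_zero.1 h3)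

lemma existsUnique_isCenter_even (hx : maxStep x < 0.6) (i : ℤ) :
    ∃! p, IsCenter cubicLaneRiesenfeldMask x (2 * i) p := by
  obtain ⟨p, hp⟩ := exists_isCenter_even x i
  refine ⟨p, hp, fun q hq => ?_⟩
  obtain ⟨-, l, hl, h⟩ := even_minimizer (norm_coe_sphere _) (norm_coe_sphere _)
    (norm_coe_sphere _) (norm_coe_sphere p) (geoDist_sub_one_le_maxStep x i)
    (geoDist_le_maxStep x i) hx hp.le_of_even
  exact (Subtype.ext (eq_of_mul_norm_sub_sq_le hl (h q (norm_coe_sphere q))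
    (hq.le_of_even p (norm_coe_sphere p)))).symm

lemma neg_one_lt_inner_of_geoDist_lt {p q : Sphere n} (h : geoDist p q < 0.6) :
    -1 < inner ℝ (p : EuclideanSpace ℝ (Fin (n + 1))) q := by
  refine (inner_mem_Icc (norm_coe_sphere p) (norm_coe_sphere q)).1.lt_of_ne fun h' => ?_
  rw [geoDist, ← h', Real.arccos_neg_one] at h
  linarith [Real.pi_gt_three]

/-- The unit vector in the direction of `p + q`. -/
noncomputable def chordMid (p q : Sphere n) : EuclideanSpace ℝ (Fin (n + 1)) :=
  ‖(p + q : EuclideanSpace ℝ (Fin (n + 1)))‖⁻¹ • (p + q)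

lemma norm_chordMid {p q : Sphere n} (h : geoDist p q < 0.6) : ‖chordMid p q‖ = 1 :=
  norm_smul_inv_norm (norm_pos_iff.1 (norm_add_pos (norm_coe_sphere p) (norm_coe_sphere q)
    (neg_one_lt_inner_of_geoDist_lt h)))

lemma isCenter_odd_iff {i : ℤ} (hx : geoDist (x i) (x (i + 1)) < 0.6) (p : Sphere n) :
    IsCenter cubicLaneRiesenfeldMask x (2 * i + 1) p ↔
      (p : EuclideanSpace ℝ (Fin (n + 1))) = chordMid (x i) (x (i + 1)) := by
  obtain ⟨l, hl, h⟩ := odd_minimizer (norm_coe_sphere (x i)) (norm_coe_sphere (x (i + 1)))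
    (neg_one_lt_inner_of_geoDist_lt hx)
  constructor
  · intro hp
    have h1 := hp ⟨_, mem_sphere_zero_iff_norm.2 (norm_chordMid hx)⟩
    rw [energy_odd, energy_odd] at h1
    exact (eq_of_mul_norm_sub_sq_le hl (h p (norm_coe_sphere p)) h1).symm
  · intro hp q
    rw [energy_odd, energy_odd, hp]
    have h1 := h q (norm_coe_sphere q)
    refine le_trans ?_ h1
    exact le_add_of_nonneg_right (by positivity)

lemma existsUnique_isCenter_odd {i : ℤ} (hx : geoDist (x i) (x (i + 1)) < 0.6) :
    ∃! p, IsCenter cubicLaneRiesenfeldMask x (2 * i + 1) p :=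
  ⟨⟨_, mem_sphere_zero_iff_norm.2 (norm_chordMid hx)⟩, (isCenter_odd_iff hx _).2 rfl, fun _ hq =>
    Subtype.ext ((isCenter_odd_iff hx _).1 hq)⟩

lemma existsUnique_isCenter (hx : maxStep x < 0.6) (i : ℤ) :
    ∃! p, IsCenter cubicLaneRiesenfeldMask x i p := by
  obtain ⟨j, rfl | rfl⟩ := Int.even_or_odd' i
  · exact existsUnique_isCenter_even hx j
  · exact existsUnique_isCenter_odd ((geoDist_le_maxStep x j).trans_lt hx)

/-- One round of the refinement. -/
noncomputable abbrev refined (x : ℤ → Sphere n) : ℤ → Sphere n :=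
  riemannianAnalogue cubicLaneRiesenfeldMask x

lemma isCenter_refine (hx : maxStep x < 0.6) (i : ℤ) :
    IsCenter cubicLaneRiesenfeldMask x i (refined x i) := by
  have h := existsUnique_isCenter hx i
  rw [refined, riemannianAnalogue, dif_pos h]
  exact h.choose_spec.1

lemma coe_refine_odd (hx : maxStep x < 0.6) (i : ℤ) :
    (refined x (2 * i + 1) : EuclideanSpace ℝ (Fin (n + 1))) = chordMid (x i) (x (i + 1)) :=
  (isCenter_odd_iff ((geoDist_le_maxStep x i).trans_lt hx) _).1 (isCenter_refine hx _)

/-! ### Displacement and contraction -/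

lemma norm_refine_even_sub_le (hx : maxStep x < 0.6) (i : ℤ) :
    ‖(refined x (2 * i) : EuclideanSpace ℝ (Fin (n + 1))) - x i‖ ≤ 0.28 * maxStep x :=
  (even_minimizer (norm_coe_sphere _) (norm_coe_sphere _)
    (norm_coe_sphere _) (norm_coe_sphere _) (geoDist_sub_one_le_maxStep x i)
    (geoDist_le_maxStep x i) hx (isCenter_refine hx _).le_of_even).1

lemma geoDist_refine_even_le (hx : maxStep x < 0.6) (i : ℤ) :
    geoDist (refined x (2 * i)) (x i) ≤ 0.45 * maxStep x := by
  have h1 := arccos_le_norm_sub (norm_coe_sphere (refined x (2 * i))) (norm_coe_sphere (x i))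
  have h2 := norm_refine_even_sub_le hx i
  have h3 := mul_le_mul_of_nonneg_left h2 (by positivity : 0 ≤ Real.pi / 2)
  -- Passing from chord to angle costs `π / 2`, and `1.6 * 0.28 = 0.448 ≤ 0.45`.
  have h4 : Real.pi / 2 ≤ 1.6 := by linarith [Real.pi_lt_d2]
  have h5 := mul_le_mul_of_nonneg_right h4
    (mul_nonneg (by norm_num : (0 : ℝ) ≤ 0.28) (maxStep_nonneg x))
  rw [geoDist]
  linarith [maxStep_nonneg x]

lemma geoDist_refine_odd_le (hx : maxStep x < 0.6) (i : ℤ) :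
    geoDist (refined x (2 * i + 1)) (x i) ≤ maxStep x / 2 ∧
      geoDist (refined x (2 * i + 1)) (x (i + 1)) ≤ maxStep x / 2 := by
  have hd := geoDist_le_maxStep x i
  obtain ⟨h1, h2⟩ := inner_normalize_add_left (norm_coe_sphere (x i)) (norm_coe_sphere (x (i + 1)))
    (neg_one_lt_inner_of_geoDist_lt (hd.trans_lt hx))
  have h3 := arccos_norm_add_div_two (norm_coe_sphere (x i)) (norm_coe_sphere (x (i + 1)))
  unfold geoDist at hd ⊢
  rw [coe_refine_odd hx, chordMid, h1, h2, h3]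
  constructor <;> linarith

/-- Neighbouring refined points are an even and an odd one, both near a common old point: `0.45 +
1/2 = 0.95`. -/
lemma maxStep_refine_le (hx : maxStep x < 0.6) : maxStep (refined x) ≤ 0.95 * maxStep x := by
  refine ciSup_le fun l => ?_
  obtain ⟨j, rfl | rfl⟩ := Int.even_or_odd' l
  · have h1 := geoDist_triangle (refined x (2 * j)) (x j) (refined x (2 * j + 1))
    have h2 := geoDist_refine_even_le hx j
    have h3 := (geoDist_refine_odd_le hx j).1
    rw [geoDist_comm] at h3
    linarith
  · have h1 := geoDist_triangle (refined x (2 * j + 1)) (x (j + 1)) (refined x (2 * j + 1 + 1))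
    have h2 := geoDist_refine_even_le hx (j + 1)
    have h3 := (geoDist_refine_odd_le hx j).2
    rw [geoDist_comm, show 2 * (j + 1) = 2 * j + 1 + 1 by ring] at h2
    linarith

lemma maxStep_iterate_le (hx : maxStep x < 0.6) (k : ℕ) :
    maxStep (refined^[k] x) ≤ 0.95 ^ k * maxStep x := by
  induction k with
  | zero => simp
  | succ k ih =>
    have h0 := maxStep_nonneg x
    have hk : maxStep (refined^[k] x) < 0.6 :=
      (ih.trans (mul_le_of_le_one_left h0 (pow_le_one₀ (by norm_num) (by norm_num)))).trans_lt hx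
    rw [Function.iterate_succ_apply']
    refine (maxStep_refine_le hk).trans ?_
    rw [pow_succ]
    linarith

lemma maxStep_iterate_lt (hx : maxStep x < 0.6) (k : ℕ) : maxStep (refined^[k] x) < 0.6 :=
  ((maxStep_iterate_le hx k).trans (mul_le_of_le_one_left (maxStep_nonneg x)
    (pow_le_one₀ (by norm_num) (by norm_num)))).trans_lt hx

lemma wellDefinedFor (hx : maxStep x < 0.6) : WellDefinedFor cubicLaneRiesenfeldMask x :=
  fun k i => existsUnique_isCenter (maxStep_iterate_lt hx k) i

lemma contractiveFor (hx : maxStep x < 0.6) :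
    ContractiveFor cubicLaneRiesenfeldMask 0.95 x := fun i k => by
  rw [geoDist_comm]
  exact (geoDist_le_maxStep _ i).trans (maxStep_iterate_le hx k)

lemma displacementSafeFor (hx : maxStep x < 0.6) :
    DisplacementSafeFor cubicLaneRiesenfeldMask 0.45 x := fun i => geoDist_refine_even_le hx i

end Sphere

/-! ### Second order proximity to the linear rule -/

section Proximity

variable {E : Type*} [NormedAddCommGroup E] [InnerProductSpace ℝ E] {ι : Type*}
variable {s : Finset ι} {a : ι → ℝ} {x : ι → E}

/-- From `θ / sin θ ≤ 1 / c` one gets `(1 - c) / c`, and `c ≥ 1/2`. -/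
lemma angleRatio_sub_one_le {c : ℝ} (h : 1 / 2 ≤ c) (h1 : c ≤ 1) :
    angleRatio c - 1 ≤ 2 * (1 - c) := by
  have h2 := angleRatio_mul_le_one (by linarith : 0 < c) h1
  have h3 := one_le_angleRatio (by linarith : -1 < c)
  nlinarith

/-- The gradient at the normalized weighted mean is of third order. -/
lemma norm_tangential_pull_le_of_mean (ha : ∀ j ∈ s, 0 ≤ a j) (hx : ∀ j ∈ s, ‖x j‖ = 1) {q : E}
    (hq : ‖q‖ = 1) {r σ : ℝ} (hr : r ≤ 1) (hqx : ∀ j ∈ s, ‖q - x j‖ ≤ r)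
    (hmean : ∑ j ∈ s, a j • x j = σ • q) :
    ‖pull s a x q - (inner ℝ (pull s a x q) q : ℝ) • q‖ ≤ ∑ j ∈ s, a j * r ^ 3 := by
  have h0 : ∑ j ∈ s, a j • (x j - (inner ℝ (x j) q : ℝ) • q) = 0 := by
    have h1 : ∑ j ∈ s, a j * inner ℝ (x j) q = σ := by
      have h2 : inner ℝ (∑ j ∈ s, a j • x j) q = σ := by
        rw [hmean, real_inner_smul_left, real_inner_self_eq_norm_sq, hq]; ring
      simpa only [sum_inner, real_inner_smul_left] using h2
    simp only [smul_sub, Finset.sum_sub_distrib, hmean, smul_smul, ← Finset.sum_smul, h1, sub_self]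
  -- At the mean direction the tangential parts cancel with coefficients `a j`, so `angleRatio` may
  -- be replaced by `angleRatio - 1`. This is of second order and multiplies a first order vector.
  have h1 : pull s a x q - (inner ℝ (pull s a x q) q : ℝ) • q =
      ∑ j ∈ s, (a j * (angleRatio (inner ℝ q (x j)) - 1)) • (x j - (inner ℝ (x j) q : ℝ) • q) := by
    rw [tangential_pull, ← sub_zero (∑ j ∈ s, _), ← h0, ← Finset.sum_sub_distrib]
    refine Finset.sum_congr rfl fun j _ => ?_
    rw [← sub_smul]; congr 1; ring
  rw [h1]
  refine (norm_sum_le _ _).trans (Finset.sum_le_sum fun j hj => ?_)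
  have hn := norm_nonneg (q - x j)
  have hr0 : 0 ≤ r := hn.trans (hqx j hj)
  have hsq : ‖q - x j‖ ^ 2 ≤ r ^ 2 := pow_le_pow_left₀ hn (hqx j hj) 2
  have hc := inner_eq_of_unit hq (hx j hj)
  have hc1 : 1 / 2 ≤ inner ℝ q (x j) := by
    rw [hc]
    nlinarith
  have h2 := angleRatio_sub_one_le hc1 (inner_mem_Icc hq (hx j hj)).2
  have h3 := one_le_angleRatio (by linarith : -1 < inner ℝ q (x j))
  have h4 : ‖x j - (inner ℝ (x j) q : ℝ) • q‖ ≤ r :=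
    (norm_tangential_le (hx j hj) hq).trans (by rw [norm_sub_rev]; exact hqx j hj)
  have h5 : angleRatio (inner ℝ q (x j)) - 1 ≤ r ^ 2 := by
    rw [hc] at h2 ⊢
    linarith
  rw [norm_smul, norm_mul, Real.norm_of_nonneg (ha j hj), Real.norm_of_nonneg (by linarith),
    mul_assoc]
  refine mul_le_mul_of_nonneg_left ?_ (ha j hj)
  calc _ ≤ r ^ 2 * r := mul_le_mul h5 h4 (norm_nonneg _) (sq_nonneg r)
    _ = r ^ 3 := by ring

/-- Normalizing a vector of norm close to one. -/
lemma norm_normalize_sub_le {w y : E} {t η c : ℝ} (hw0 : 0 < ‖w‖) (hw : ‖w‖ ≤ 1)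
    (ht : 0 ≤ t) (hη : |1 - ‖w‖ ^ 2 - 2 * t| ≤ η) (hc : ‖w - y‖ ≤ c) :
    ‖‖w‖⁻¹ • w - y‖ ≤ (1 - ‖w‖ ^ 2) + c ∧
      ‖‖w‖⁻¹ • w - w - t • y‖ ≤
        (1 - ‖w‖ ^ 2) ^ 2 / 2 + η / 2 + t * ((1 - ‖w‖ ^ 2) + c) := by
  set σ := ‖w‖ with hσ
  set m := σ⁻¹ • w with hm
  have hmn : ‖m‖ = 1 := norm_smul_inv_norm (norm_pos_iff.1 hw0)
  have hw' : w = σ • m := by rw [hm, smul_smul, mul_inv_cancel₀ hw0.ne', one_smul]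
  have hd : 1 - σ ≤ 1 - σ ^ 2 := by nlinarith
  have h1 : m - w = (1 - σ) • m := by rw [sub_smul, one_smul, ← hw']
  have h2 : ‖m - w‖ = 1 - σ := by
    rw [h1, norm_smul, hmn, mul_one, Real.norm_of_nonneg (by linarith)]
  have h3 : ‖m - y‖ ≤ (1 - σ ^ 2) + c :=
    (norm_sub_le_norm_sub_add_norm_sub m w y).trans (by linarith)
  refine ⟨h3, ?_⟩
  have h4 : m - w - t • y = (1 - σ - t) • m + t • (m - y) := by
    rw [h1]; module
  rw [h4]
  refine (norm_add_le _ _).trans ?_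
  rw [norm_smul _ m, norm_smul _ (m - y), hmn, mul_one, Real.norm_of_nonneg ht, Real.norm_eq_abs]
  refine add_le_add ?_ (mul_le_mul_of_nonneg_left h3 ht)
  -- Expands `1 - σ` as `(1 - σ ^ 2) / 2` plus a term quadratic in the defect; `t` is the predicted
  -- half-defect.
  have h5 : 1 - σ - t = (1 - σ) ^ 2 / 2 + (1 - σ ^ 2 - 2 * t) / 2 := by ring
  have h6 : (1 - σ) ^ 2 ≤ (1 - σ ^ 2) ^ 2 := pow_le_pow_left₀ (by linarith) hd 2
  rw [h5]
  refine (abs_add_le _ _).trans (add_le_add ?_ ?_)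
  · rw [abs_of_nonneg (by positivity)]; linarith
  · rw [abs_div, abs_two]; linarith

lemma odd_proximity {p q : E} (hp : ‖p‖ = 1) (hq : ‖q‖ = 1) {D : ℝ} (hD : ‖q - p‖ ≤ D)
    (hD1 : D ≤ 0.6) :
    ‖‖p + q‖⁻¹ • (p + q) - (1 / 2 : ℝ) • (p + q) - (‖q - p‖ ^ 2 / 8) • p‖ ≤ D ^ 3 := by
  set d := ‖q - p‖ with hd
  have hd0 : 0 ≤ d := norm_nonneg _
  set w := (1 / 2 : ℝ) • (p + q) with hw
  have hwn : ‖w‖ = ‖p + q‖ / 2 := by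
    rw [hw, norm_smul, Real.norm_of_nonneg (by norm_num)]; ring
  have hw2 : ‖w‖ ^ 2 = 1 - d ^ 2 / 4 := by
    rw [hwn, div_pow, norm_add_sq_of_unit hp hq, hd, norm_sub_rev, norm_sub_sq_of_unit hp hq]
    ring
  have hw0 : 0 < ‖w‖ := by
    refine (norm_nonneg w).lt_of_ne fun h => ?_
    rw [← h] at hw2
    nlinarith
  have hw1 : ‖w‖ ≤ 1 := by
    refine le_of_sq_le_sq ?_ zero_le_one
    rw [hw2]; nlinarith
  have heq : ‖p + q‖⁻¹ • (p + q) = ‖w‖⁻¹ • w := by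
    rw [hwn, hw, smul_smul]; congr 1; field_simp
  have hwp : ‖w - p‖ ≤ d / 2 := by
    have : w - p = (1 / 2 : ℝ) • (q - p) := by rw [hw]; module
    rw [this, norm_smul, Real.norm_of_nonneg (by norm_num)]; linarith
  have h := (norm_normalize_sub_le (t := d ^ 2 / 8) (η := 0) hw0 hw1 (by positivity)
    (by rw [hw2]; ring_nf; simp) hwp).2
  rw [heq]
  refine h.trans ?_
  rw [hw2]
  have h3 : d ^ 3 ≤ D ^ 3 := pow_le_pow_left₀ hd0 hD 3
  have h4 : d ^ 4 ≤ d ^ 3 := pow_le_pow_of_le_one hd0 (by linarith) (by norm_num)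
  have h5 : 0 ≤ d ^ 3 := by positivity
  linarith

/-- For unit vectors the norm defect of a weighted mean is the weighted variance, here expressed
through successive differences. -/
lemma one_sub_norm_even_mean_sq {xm x0 xp : E} (hm : ‖xm‖ = 1) (h0 : ‖x0‖ = 1)
    (hp : ‖xp‖ = 1) :
    1 - ‖(1 / 8 : ℝ) • (xm + (6 : ℝ) • x0 + xp)‖ ^ 2 =
      (6 * ‖x0 - xm‖ ^ 2 + 6 * ‖xp - x0‖ ^ 2 + ‖x0 - xm + (xp - x0)‖ ^ 2) / 64 := by
  have e0 : inner ℝ x0 x0 = (1 : ℝ) := by rw [real_inner_self_eq_norm_sq, h0]; norm_num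
  have em : inner ℝ xm xm = (1 : ℝ) := by rw [real_inner_self_eq_norm_sq, hm]; norm_num
  have ep : inner ℝ xp xp = (1 : ℝ) := by rw [real_inner_self_eq_norm_sq, hp]; norm_num
  have : x0 - xm + (xp - x0) = xp - xm := by abel
  rw [this, norm_sub_sq_of_unit h0 hm, norm_sub_sq_of_unit hp h0,
    norm_sub_sq_of_unit hp hm, ← real_inner_self_eq_norm_sq]
  simp only [inner_add_left, inner_add_right, real_inner_smul_left, real_inner_smul_right, e0,
    em, ep, real_inner_comm xm x0, real_inner_comm x0 xp, real_inner_comm xm xp]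
  ring

/-- For `u = v` the variance equals `‖v‖ ^ 2 / 4`, as for the midpoint rule. The general defect has
the factor `v - u`, a second difference. -/
lemma abs_even_defect_le {u v : E} {D ε : ℝ} (hu : ‖u‖ ≤ D) (hv : ‖v‖ ≤ D)
    (hvu : ‖v - u‖ ≤ ε) :
    |(6 * ‖u‖ ^ 2 + 6 * ‖v‖ ^ 2 + ‖u + v‖ ^ 2) / 64 - 2 * (‖v‖ ^ 2 / 8)| ≤ D * ε := by
  have hD0 : 0 ≤ D := (norm_nonneg _).trans hu
  have hε0 : 0 ≤ ε := (norm_nonneg _).trans hvu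
  have h1 : (6 * ‖u‖ ^ 2 + 6 * ‖v‖ ^ 2 + ‖u + v‖ ^ 2) / 64 - 2 * (‖v‖ ^ 2 / 8) =
      -(inner ℝ (v - u) ((7 : ℝ) • u + (9 : ℝ) • v)) / 64 := by
    rw [norm_add_sq_real]
    simp only [inner_sub_left, inner_add_right, real_inner_smul_right,
      real_inner_self_eq_norm_sq, real_inner_comm u v]
    ring
  have h2 : ‖(7 : ℝ) • u + (9 : ℝ) • v‖ ≤ 16 * D := by
    refine (norm_add_le _ _).trans ?_
    rw [norm_smul, norm_smul, Real.norm_of_nonneg (by norm_num),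
      Real.norm_of_nonneg (by norm_num)]
    linarith
  rw [h1, abs_div, abs_neg, abs_of_pos (by norm_num : (0 : ℝ) < 64), div_le_iff₀ (by norm_num)]
  calc _ ≤ ‖v - u‖ * ‖(7 : ℝ) • u + (9 : ℝ) • v‖ := abs_real_inner_le_norm _ _
    _ ≤ ε * (16 * D) := mul_le_mul hvu h2 (norm_nonneg _) hε0
    _ ≤ _ := by linarith [mul_nonneg hD0 hε0]

/-- The gradient at the normalized mean `m` is at most `r ^ 3` and the radial coefficient at least
1/2, so `norm_sub_le_of_minimizer` gives `2 r ^ 3 / (1/2)`. -/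
lemma norm_minimizer_sub_normalized_mean_le {xm x0 xp e m : E} (hm : ‖xm‖ = 1) (h0 : ‖x0‖ = 1)
    (hp : ‖xp‖ = 1) (he : ‖e‖ = 1) (hmn : ‖m‖ = 1) {σ r : ℝ} (hr : r ≤ 1)
    (hσ : (1 / 8 : ℝ) • (xm + (6 : ℝ) • x0 + xp) = σ • m)
    (cm : ‖m - xm‖ ≤ r) (c0 : ‖m - x0‖ ≤ r) (cp : ‖m - xp‖ ≤ r)
    (hmin : ∀ q : E, ‖q‖ = 1 → angleEnergy Finset.univ evenWeight ![xm, x0, xp] e ≤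
      angleEnergy Finset.univ evenWeight ![xm, x0, xp] q) :
    ‖e - m‖ ≤ 4 * r ^ 3 := by
  have hr0 : 0 ≤ r := (norm_nonneg _).trans cm
  have hall : ∀ j ∈ Finset.univ, ‖m - (![xm, x0, xp] : Fin 3 → E) j‖ ≤ r := by
    intro j _
    fin_cases j
    · exact cm
    · exact c0
    · exact cp
  have hx := norm_three hm h0 hp
  have hin : ∀ j ∈ Finset.univ, 1 / 2 ≤ inner ℝ m ((![xm, x0, xp] : Fin 3 → E) j) :=
    fun j hj => by
      have := inner_ge_of_norm_sub_le hmn (hx j hj) (hall j hj)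
      nlinarith
  have hgrad := norm_tangential_pull_le_of_mean evenWeight_nonneg hx hmn hr hall (σ := σ) (by
      rw [← hσ, Fin.sum_univ_three]
      simp only [evenWeight, Matrix.cons_val_zero, Matrix.cons_val_one, Matrix.cons_val]
      module)
  have hdist := norm_sub_le_of_minimizer evenWeight_nonneg hx he hmn
    (fun j hj => by linarith [hin j hj]) (κ := 0) (by
      rw [zero_mul, add_zero]; exact hmin m hmn)
  have hin0 : ∀ j ∈ Finset.univ, 0 ≤ inner ℝ m ((![xm, x0, xp] : Fin 3 → E) j) :=
    fun j hj => by linarith [hin j hj]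
  have hl := inner_pull_self_ge evenWeight_nonneg hin0
  have hl2 : 1 / 2 ≤ inner ℝ (pull Finset.univ evenWeight ![xm, x0, xp] m) m := by
    refine le_trans ?_ hl
    have i1 : 1 / 2 ≤ inner ℝ m xm := hin 0 (Finset.mem_univ _)
    have i2 : 1 / 2 ≤ inner ℝ m x0 := hin 1 (Finset.mem_univ _)
    have i3 : 1 / 2 ≤ inner ℝ m xp := hin 2 (Finset.mem_univ _)
    simp only [Fin.sum_univ_three, evenWeight, Matrix.cons_val_zero, Matrix.cons_val_one,
      Matrix.cons_val]
    linarith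
  have hsum : ∑ j : Fin 3, evenWeight j * r ^ 3 = r ^ 3 := by
    simp only [Fin.sum_univ_three, evenWeight, Matrix.cons_val_zero, Matrix.cons_val_one,
      Matrix.cons_val]
    ring
  rw [hsum] at hgrad
  have := mul_le_mul_of_nonneg_right hl2 (norm_nonneg (e - m))
  linarith

lemma even_proximity {xm x0 xp e : E} (hm : ‖xm‖ = 1) (h0 : ‖x0‖ = 1) (hp : ‖xp‖ = 1)
    (he : ‖e‖ = 1) {D ε : ℝ} (hD1 : D ≤ 0.6) (hu : ‖x0 - xm‖ ≤ D) (hv : ‖xp - x0‖ ≤ D)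
    (hε : ‖xp - (2 : ℝ) • x0 + xm‖ ≤ ε)
    (hmin : ∀ q : E, ‖q‖ = 1 → angleEnergy Finset.univ evenWeight ![xm, x0, xp] e ≤
      angleEnergy Finset.univ evenWeight ![xm, x0, xp] q) :
    ‖e - (1 / 8 : ℝ) • (xm + (6 : ℝ) • x0 + xp) - (‖xp - x0‖ ^ 2 / 8) • x0‖ ≤
      15 * D ^ 3 + D * ε := by
  have hD0 : 0 ≤ D := (norm_nonneg _).trans hu
  have hvu : ‖(xp - x0) - (x0 - xm)‖ ≤ ε := by
    have : (xp - x0) - (x0 - xm) = xp - (2 : ℝ) • x0 + xm := by module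
    rwa [this]
  have hη := abs_even_defect_le hu hv hvu
  have hDε : 0 ≤ D * ε := (abs_nonneg _).trans hη
  rw [← one_sub_norm_even_mean_sq hm h0 hp] at hη
  have hw2 := one_sub_norm_even_mean_sq hm h0 hp
  have hwx : ‖(1 / 8 : ℝ) • (xm + (6 : ℝ) • x0 + xp) - x0‖ ≤ D / 4 := by
    have : (1 / 8 : ℝ) • (xm + (6 : ℝ) • x0 + xp) - x0 =
      (1 / 8 : ℝ) • ((xp - x0) - (x0 - xm)) := by module
    rw [this, norm_smul, Real.norm_of_nonneg (by norm_num)]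
    have := norm_sub_le (xp - x0) (x0 - xm)
    linarith
  have hu2 : ‖x0 - xm‖ ^ 2 ≤ D ^ 2 := pow_le_pow_left₀ (norm_nonneg _) hu 2
  have hv2 : ‖xp - x0‖ ^ 2 ≤ D ^ 2 := pow_le_pow_left₀ (norm_nonneg _) hv 2
  have huv2 : ‖x0 - xm + (xp - x0)‖ ^ 2 ≤ (2 * D) ^ 2 :=
    pow_le_pow_left₀ (norm_nonneg _) ((norm_add_le _ _).trans (by linarith)) 2
  have hwD0 : 0 ≤ 1 - ‖(1 / 8 : ℝ) • (xm + (6 : ℝ) • x0 + xp)‖ ^ 2 := by rw [hw2]; positivity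
  generalize hw : (1 / 8 : ℝ) • (xm + (6 : ℝ) • x0 + xp) = w at *
  have hwD : 1 - ‖w‖ ^ 2 ≤ D ^ 2 / 4 := by rw [hw2]; linarith
  have hw0 : 0 < ‖w‖ := by
    refine (norm_nonneg w).lt_of_ne fun h => ?_
    rw [← h] at hwD
    nlinarith
  have hw1 : ‖w‖ ≤ 1 := le_of_sq_le_sq (by linarith) zero_le_one
  have ht : 0 ≤ ‖xp - x0‖ ^ 2 / 8 := by positivity
  obtain ⟨hmx, hmw⟩ := norm_normalize_sub_le hw0 hw1 ht hη hwx
  have hmn : ‖‖w‖⁻¹ • w‖ = 1 := norm_smul_inv_norm (norm_pos_iff.1 hw0)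
  have hσ : w = ‖w‖ • (‖w‖⁻¹ • w) := by rw [smul_smul, mul_inv_cancel₀ hw0.ne', one_smul]
  generalize ‖w‖⁻¹ • w = m at *
  have hDD : D ^ 2 ≤ 0.6 * D := by nlinarith
  have hm0 : ‖m - x0‖ ≤ 0.4 * D := by linarith
  have hmm : ‖m - xm‖ ≤ 1.5 * D := by
    have := norm_sub_le_norm_sub_add_norm_sub m x0 xm
    linarith
  have hmp : ‖m - xp‖ ≤ 1.5 * D := by
    have := norm_sub_le_norm_sub_add_norm_sub m x0 xp
    rw [norm_sub_rev x0 xp] at this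
    linarith
  -- With `r = 1.5 D ≤ 0.9` this contributes `13.5 D ^ 3`, the bulk of the final `15 D ^ 3`.
  have hem := norm_minimizer_sub_normalized_mean_le hm h0 hp he hmn (by linarith)
    (hw.trans hσ) hmm (hm0.trans (by linarith)) hmp hmin
  have hsplit : e - w - (‖xp - x0‖ ^ 2 / 8) • x0 =
      (e - m) + (m - w - (‖xp - x0‖ ^ 2 / 8) • x0) := by abel
  rw [hsplit]
  refine (norm_add_le _ _).trans ?_
  have hD3 : 0 ≤ D ^ 3 := by positivity
  have hD4 : D ^ 4 ≤ D ^ 3 := pow_le_pow_of_le_one hD0 (by linarith) (by norm_num)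
  have h7 : (1 - ‖w‖ ^ 2) ^ 2 ≤ (D ^ 2 / 4) ^ 2 := pow_le_pow_left₀ hwD0 hwD 2
  have h8 : ‖xp - x0‖ ^ 2 / 8 * ((1 - ‖w‖ ^ 2) + D / 4) ≤ D ^ 2 / 8 * (D ^ 2 / 4 + D / 4) :=
    mul_le_mul (by linarith) (by linarith) (by linarith) (by positivity)
  linarith

end Proximity

/-! ### The linear cubic rule and its differences -/

section Differences

variable {V : Type*} [NormedAddCommGroup V]

/-- Forward differences. -/
def fd (f : ℤ → V) (i : ℤ) : V := f (i + 1) - f i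

lemma fd_pred (f : ℤ → V) (i : ℤ) : fd f (i - 1) = f i - f (i - 1) := by
  rw [fd, sub_add_cancel]

lemma fd_add (f g : ℤ → V) : fd (f + g) = fd f + fd g := by
  funext i
  simp only [fd, Pi.add_apply]
  abel

/-- `c` bounds the sequence `f`. -/
def BoundedBy (f : ℤ → V) (c : ℝ) : Prop := ∀ i, ‖f i‖ ≤ c

lemma BoundedBy.fd {f : ℤ → V} {c : ℝ} (h : BoundedBy f c) : BoundedBy (fd f) (2 * c) :=
  fun i => (norm_sub_le _ _).trans (by linarith [h i, h (i + 1)])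

lemma BoundedBy.add {f g : ℤ → V} {c d : ℝ} (hf : BoundedBy f c) (hg : BoundedBy g d) :
    BoundedBy (f + g) (c + d) :=
  fun i => (norm_add_le _ _).trans (add_le_add (hf i) (hg i))

/-- The supremum norm of a sequence. -/
noncomputable def supNorm (f : ℤ → V) : ℝ := ⨆ i, ‖f i‖

lemma BoundedBy.supNorm_le {f : ℤ → V} {c : ℝ} (h : BoundedBy f c) : supNorm f ≤ c := ciSup_le h

lemma BoundedBy.boundedBy_supNorm {f : ℤ → V} {c : ℝ} (h : BoundedBy f c) :
    BoundedBy f (supNorm f) :=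
  le_ciSup (f := fun i => ‖f i‖) ⟨c, by rintro _ ⟨i, rfl⟩; exact h i⟩

lemma supNorm_nonneg (f : ℤ → V) : 0 ≤ supNorm f := Real.iSup_nonneg fun _ => norm_nonneg _

end Differences

section Linear

variable {V : Type*} [NormedAddCommGroup V] [NormedSpace ℝ V]

/-- The linear cubic Lane-Riesenfeld rule. -/
noncomputable def linearRule (f : ℤ → V) (j : ℤ) : V :=
  if Even j then (1 / 8 : ℝ) • (f (j / 2 - 1) + (6 : ℝ) • f (j / 2) + f (j / 2 + 1))
  else (1 / 2 : ℝ) • (f (j / 2) + f (j / 2 + 1))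

lemma linearRule_even (f : ℤ → V) (i : ℤ) :
    linearRule f (2 * i) = (1 / 8 : ℝ) • (f (i - 1) + (6 : ℝ) • f i + f (i + 1)) := by
  rw [linearRule, if_pos (even_two_mul i), Int.mul_ediv_cancel_left _ two_ne_zero]

lemma linearRule_odd (f : ℤ → V) (i : ℤ) :
    linearRule f (2 * i + 1) = (1 / 2 : ℝ) • (f i + f (i + 1)) := by
  rw [linearRule, if_neg (by simp), show (2 * i + 1) / 2 = i by omega]

lemma fd_linearRule_even (f : ℤ → V) (i : ℤ) :
    fd (linearRule f) (2 * i) = (1 / 8 : ℝ) • ((3 : ℝ) • fd f i + fd f (i - 1)) := by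
  rw [fd, linearRule_odd, linearRule_even, fd, fd, sub_add_cancel]
  module

lemma fd_linearRule_odd (f : ℤ → V) (i : ℤ) :
    fd (linearRule f) (2 * i + 1) = (1 / 8 : ℝ) • ((3 : ℝ) • fd f i + fd f (i + 1)) := by
  rw [fd, show 2 * i + 1 + 1 = 2 * (i + 1) by ring, linearRule_odd, linearRule_even, fd, fd,
    add_sub_cancel_right]
  module

lemma fd_fd_linearRule_even (f : ℤ → V) (i : ℤ) :
    fd (fd (linearRule f)) (2 * i) = (1 / 8 : ℝ) • (fd (fd f) i + fd (fd f) (i - 1)) := by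
  have h : fd (fd f) i = fd f (i + 1) - fd f i := rfl
  rw [fd, fd_linearRule_even, fd_linearRule_odd, fd_pred (fd f), h]
  module

lemma fd_fd_linearRule_odd (f : ℤ → V) (i : ℤ) :
    fd (fd (linearRule f)) (2 * i + 1) = (1 / 4 : ℝ) • fd (fd f) i := by
  have h : fd (fd f) i = fd f (i + 1) - fd f i := rfl
  rw [fd, show 2 * i + 1 + 1 = 2 * (i + 1) by ring, fd_linearRule_even, fd_linearRule_odd, h,
    add_sub_cancel_right]
  module

lemma fd_fd_fd_linearRule_even (f : ℤ → V) (i : ℤ) :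
    fd (fd (fd (linearRule f))) (2 * i) = (1 / 8 : ℝ) • fd (fd (fd f)) (i - 1) := by
  rw [fd, fd_fd_linearRule_even, fd_fd_linearRule_odd, fd_pred (fd (fd f))]
  module

lemma fd_fd_fd_linearRule_odd (f : ℤ → V) (i : ℤ) :
    fd (fd (fd (linearRule f))) (2 * i + 1) = (1 / 8 : ℝ) • fd (fd (fd f)) i := by
  have h : fd (fd (fd f)) i = fd (fd f) (i + 1) - fd (fd f) i := rfl
  rw [fd, show 2 * i + 1 + 1 = 2 * (i + 1) by ring, fd_fd_linearRule_even, fd_fd_linearRule_odd,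
    h, add_sub_cancel_right]
  module

lemma norm_combination_le {u v : V} {a b d : ℝ} (ha : 0 ≤ a) (hb : 0 ≤ b) (hu : ‖u‖ ≤ d)
    (hv : ‖v‖ ≤ d) : ‖a • u + b • v‖ ≤ (a + b) * d := by
  refine (norm_add_le _ _).trans ?_
  rw [norm_smul, norm_smul, Real.norm_of_nonneg ha, Real.norm_of_nonneg hb, add_mul]
  exact add_le_add (mul_le_mul_of_nonneg_left hu ha) (mul_le_mul_of_nonneg_left hv hb)

/-- The coefficients 3/8 and 1/8 of the derived rule are positive and sum to 1/2. -/
lemma BoundedBy.fd_linearRule {f : ℤ → V} {d : ℝ} (h : BoundedBy (SphereSubdivision.fd f) d) :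
    BoundedBy (SphereSubdivision.fd (linearRule f)) (d / 2) := by
  intro j
  obtain ⟨i, rfl | rfl⟩ := Int.even_or_odd' j
  · rw [fd_linearRule_even, smul_add, smul_smul]
    exact (norm_combination_le (by norm_num) (by norm_num) (h i) (h _)).trans
      (le_of_eq (by ring))
  · rw [fd_linearRule_odd, smul_add, smul_smul]
    exact (norm_combination_le (by norm_num) (by norm_num) (h i) (h _)).trans
      (le_of_eq (by ring))

lemma BoundedBy.fd_fd_linearRule {f : ℤ → V} {d : ℝ}
    (h : BoundedBy (SphereSubdivision.fd (SphereSubdivision.fd f)) d) :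
    BoundedBy (SphereSubdivision.fd (SphereSubdivision.fd (linearRule f))) (d / 4) := by
  intro j
  obtain ⟨i, rfl | rfl⟩ := Int.even_or_odd' j
  · rw [fd_fd_linearRule_even, smul_add]
    exact (norm_combination_le (by norm_num) (by norm_num) (h i) (h _)).trans
      (le_of_eq (by ring))
  · rw [fd_fd_linearRule_odd, norm_smul, Real.norm_of_nonneg (by norm_num)]
    linarith [h i]

lemma BoundedBy.fd_fd_fd_linearRule {f : ℤ → V} {d : ℝ}
    (h : BoundedBy (SphereSubdivision.fd (SphereSubdivision.fd (SphereSubdivision.fd f))) d) :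
    BoundedBy (SphereSubdivision.fd (SphereSubdivision.fd
      (SphereSubdivision.fd (linearRule f)))) (d / 8) := by
  intro j
  obtain ⟨i, rfl | rfl⟩ := Int.even_or_odd' j
  · rw [fd_fd_fd_linearRule_even, norm_smul, Real.norm_of_nonneg (by norm_num)]
    linarith [h (i - 1)]
  · rw [fd_fd_fd_linearRule_odd, norm_smul, Real.norm_of_nonneg (by norm_num)]
    linarith [h i]

end Linear

/-! ### Decay of differences of a perturbed linear rule -/

/-- Adding 1 to `u` absorbs the inhomogeneous term, and the product of the factors `1 + B q ^ k` is
at most the exponential of a geometric series. -/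
lemma exists_bound_of_le_one_add_geometric {u : ℕ → ℝ} {B q : ℝ} (hu : ∀ k, 0 ≤ u k)
    (hq : q < 1) (h : ∀ k, u (k + 1) ≤ (1 + B * q ^ k) * u k + B * q ^ k)
    (hB : 0 ≤ B) (hq0 : 0 ≤ q) :
    ∃ K ≥ 0, ∀ k, u k ≤ K := by
  have hq1 : (1 - q) ≠ 0 := by linarith
  have key : ∀ k, u k + 1 ≤ (u 0 + 1) * Real.exp (B * ((1 - q ^ k) / (1 - q))) := by
    intro k
    induction k with
    | zero => simp
    | succ k ih =>
      have h1 : u (k + 1) + 1 ≤ (1 + B * q ^ k) * (u k + 1) := by linarith [h k]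
      have h2 : 1 + B * q ^ k ≤ Real.exp (B * q ^ k) := by
        linarith [Real.add_one_le_exp (B * q ^ k)]
      have h3 : B * ((1 - q ^ (k + 1)) / (1 - q)) =
          B * q ^ k + B * ((1 - q ^ k) / (1 - q)) := by
        field_simp
        ring
      rw [h3, Real.exp_add]
      calc _ ≤ _ := h1
        _ ≤ Real.exp (B * q ^ k) * ((u 0 + 1) * Real.exp (B * ((1 - q ^ k) / (1 - q)))) :=
            mul_le_mul h2 ih (by linarith [hu k]) (Real.exp_pos _).le
        _ = _ := by ring
  refine ⟨(u 0 + 1) * Real.exp (B * (1 / (1 - q))), by have := hu 0; positivity, fun k => ?_⟩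
  have h1 : Real.exp (B * ((1 - q ^ k) / (1 - q))) ≤ Real.exp (B * (1 / (1 - q))) := by
    refine Real.exp_le_exp.2 (mul_le_mul_of_nonneg_left ?_ hB)
    exact div_le_div_of_nonneg_right (by linarith [pow_nonneg hq0 k]) (by linarith)
  have h2 := mul_le_mul_of_nonneg_left h1 (by linarith [hu 0] : 0 ≤ u 0 + 1)
  linarith [key k]

section Decay

variable {V : Type*} [NormedAddCommGroup V] [NormedSpace ℝ V]

/-- A sequence of refinements that contracts and that follows the linear cubic
rule up to second order perturbations. -/
structure NearLinear (x : ℕ → ℤ → V) (A μ C : ℝ) : Prop where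
  nonneg_A : 0 ≤ A
  nonneg_C : 0 ≤ C
  nonneg_μ : 0 ≤ μ
  lt_one : μ < 1
  contract : ∀ k, BoundedBy (fd (x k)) (A * μ ^ k)
  proximity : ∀ k D, BoundedBy (fd (x k)) D → D ≤ A →
    BoundedBy (x (k + 1) - linearRule (x k)) (C * D ^ 2)
  proximity_fd : ∀ k D ε, BoundedBy (fd (x k)) D → D ≤ A → BoundedBy (fd (fd (x k))) ε →
    BoundedBy (fd (x (k + 1) - linearRule (x k))) (C * (D ^ 3 + D * ε))

variable {x : ℕ → ℤ → V} {A μ C : ℝ}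

/-- One factor of the quadratic error `C D ^ 2` is bounded by the a priori decay `A μ ^ k`. This
makes the error a summable relative perturbation of the rate 1/2, whatever `μ < 1` is. -/
lemma NearLinear.decay_fd (h : NearLinear x A μ C) :
    ∃ K ≥ 0, ∀ k, supNorm (fd (x k)) ≤ K * (1 / 2) ^ k := by
  have hA := h.nonneg_A
  have hC := h.nonneg_C
  have hstep : ∀ k, 2 ^ (k + 1) * supNorm (fd (x (k + 1))) ≤
      (1 + 4 * C * A * μ ^ k) * (2 ^ k * supNorm (fd (x k))) + 4 * C * A * μ ^ k := by
    intro k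
    have hb := (h.contract k).boundedBy_supNorm
    have hs := (h.contract k).supNorm_le
    have hs0 := supNorm_nonneg (fd (x k))
    have hμ0 : 0 ≤ μ ^ k := pow_nonneg h.nonneg_μ k
    have hsA : supNorm (fd (x k)) ≤ A :=
      hs.trans (mul_le_of_le_one_right hA (pow_le_one₀ h.nonneg_μ h.lt_one.le))
    have h1 := hb.fd_linearRule.add (h.proximity k _ hb hsA).fd
    rw [← fd_add, add_sub_cancel] at h1
    have h2 := h1.supNorm_le
    have h3 : C * supNorm (fd (x k)) ^ 2 ≤ C * A * μ ^ k * supNorm (fd (x k)) := by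
      rw [pow_two, ← mul_assoc]
      refine mul_le_mul_of_nonneg_right ?_ hs0
      rw [mul_assoc]
      exact mul_le_mul_of_nonneg_left hs hC
    have h4 : supNorm (fd (x (k + 1))) ≤ supNorm (fd (x k)) / 2 +
        2 * (C * A * μ ^ k * supNorm (fd (x k))) := by linarith
    have h5 := mul_le_mul_of_nonneg_left h4 (by positivity : (0 : ℝ) ≤ 2 ^ (k + 1))
    have h6 : 0 ≤ 4 * C * A * μ ^ k := by positivity
    rw [pow_succ] at h5 ⊢
    linarith
  obtain ⟨K, hK0, hK⟩ := exists_bound_of_le_one_add_geometric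
    (fun k => mul_nonneg (by positivity) (supNorm_nonneg (fd (x k)))) h.lt_one hstep
    (by positivity) h.nonneg_μ
  refine ⟨K, hK0, fun k => ?_⟩
  rw [one_div, inv_pow, ← div_eq_mul_inv, le_div_iff₀ (by positivity)]
  linarith [hK k]

lemma NearLinear.bounded_fd (h : NearLinear x A μ C) (k : ℕ) :
    BoundedBy (fd (x k)) (supNorm (fd (x k))) := (h.contract k).boundedBy_supNorm

lemma NearLinear.bounded_fd_fd (h : NearLinear x A μ C) (k : ℕ) :
    BoundedBy (fd (fd (x k))) (supNorm (fd (fd (x k)))) := (h.contract k).fd.boundedBy_supNorm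

lemma NearLinear.supNorm_fd_le (h : NearLinear x A μ C) (k : ℕ) : supNorm (fd (x k)) ≤ A :=
  (h.contract k).supNorm_le.trans
    (mul_le_of_le_one_right h.nonneg_A (pow_le_one₀ h.nonneg_μ h.lt_one.le))

/-- Once first differences are `O(2⁻ᵏ)`, the error `D ^ 3 + D ε` scaled by `4 ^ k` is a summable
perturbation of the rate 1/4. -/
lemma NearLinear.decay_fd_fd (h : NearLinear x A μ C) {K : ℝ} (hK0 : 0 ≤ K)
    (hK : ∀ k, supNorm (fd (x k)) ≤ K * (1 / 2) ^ k) :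
    ∃ L ≥ 0, ∀ k, supNorm (fd (fd (x k))) ≤ L * (1 / 4) ^ k := by
  have hC := h.nonneg_C
  have hstep : ∀ k, 4 ^ (k + 1) * supNorm (fd (fd (x (k + 1)))) ≤
      (1 + 8 * C * (K + K ^ 3) * (1 / 2) ^ k) * (4 ^ k * supNorm (fd (fd (x k)))) +
        8 * C * (K + K ^ 3) * (1 / 2) ^ k := by
    intro k
    have h1 := (h.bounded_fd_fd k).fd_fd_linearRule.add
      (h.proximity_fd k _ _ (h.bounded_fd k) (h.supNorm_fd_le k) (h.bounded_fd_fd k)).fd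
    rw [← fd_add, ← fd_add, add_sub_cancel] at h1
    have h2 := h1.supNorm_le
    have hd := hK k
    have hd0 := supNorm_nonneg (fd (x k))
    have he0 := supNorm_nonneg (fd (fd (x k)))
    generalize supNorm (fd (x k)) = d at *
    generalize supNorm (fd (fd (x k))) = e at *
    have h3 : d ^ 3 ≤ (K * (1 / 2) ^ k) ^ 3 := pow_le_pow_left₀ hd0 hd 3
    have h4 : d * e ≤ K * (1 / 2) ^ k * e := mul_le_mul_of_nonneg_right hd he0
    have h5 : C * (d ^ 3 + d * e) ≤ C * ((K * (1 / 2) ^ k) ^ 3 + K * (1 / 2) ^ k * e) :=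
      mul_le_mul_of_nonneg_left (add_le_add h3 h4) hC
    have h6 : supNorm (fd (fd (x (k + 1)))) ≤
        e / 4 + 2 * (C * ((K * (1 / 2) ^ k) ^ 3 + K * (1 / 2) ^ k * e)) := by linarith
    have h7 := mul_le_mul_of_nonneg_left h6 (by positivity : (0 : ℝ) ≤ 4 ^ (k + 1))
    have h8 : (4 : ℝ) ^ k * ((1 / 2) ^ k) ^ 3 = (1 / 2) ^ k := by
      rw [← pow_mul, mul_comm k 3, pow_mul, ← mul_pow]; norm_num
    have h9 : (4 : ℝ) ^ (k + 1) * (e / 4 + 2 * (C * ((K * (1 / 2) ^ k) ^ 3 + K * (1 / 2) ^ k * e)))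
        = 4 ^ k * e + 8 * C * (K ^ 3 * (4 ^ k * ((1 / 2) ^ k) ^ 3) +
          K * (1 / 2) ^ k * (4 ^ k * e)) := by ring
    rw [h9, h8] at h7
    have h10 : 0 ≤ 8 * C * K * (1 / 2) ^ k := by positivity
    have h11 : 0 ≤ 8 * C * K ^ 3 * (1 / 2) ^ k * (4 ^ k * e) := by positivity
    linarith
  obtain ⟨L, hL0, hL⟩ := exists_bound_of_le_one_add_geometric
    (fun k => mul_nonneg (by positivity) (supNorm_nonneg (fd (fd (x k))))) (by norm_num) hstep
    (by positivity) (by norm_num)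
  refine ⟨L, hL0, fun k => ?_⟩
  rw [one_div, inv_pow, ← div_eq_mul_inv, le_div_iff₀ (by positivity)]
  linarith [hL k]

/-- Homogeneous part and source both decay like `2⁻ᵏ`; the slower rate 3/4 avoids the resonant
factor `k`. The constant comes from `4 * (3/4 - 1/2) = 1`. -/
lemma le_geometric_of_le_half_add {v : ℕ → ℝ} {M : ℝ} (hv : 0 ≤ v 0) (hM : 0 ≤ M)
    (h : ∀ k, v (k + 1) ≤ v k / 2 + M * (1 / 2) ^ k) (k : ℕ) :
    v k ≤ (v 0 + 4 * M) * (3 / 4) ^ k := by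
  induction k with
  | zero => simp; linarith
  | succ k ih =>
    have h1 : M * (1 / 2) ^ k ≤ M * (3 / 4) ^ k :=
      mul_le_mul_of_nonneg_left (pow_le_pow_left₀ (by norm_num) (by norm_num) k) hM
    have h2 : 0 ≤ v 0 * (3 / 4) ^ k := by positivity
    have h3 := h k
    rw [pow_succ]
    linarith

/-- The differences decay like those of samples of a `C²` curve. -/
lemma NearLinear.decay (h : NearLinear x A μ C) :
    ∃ K ≥ 0, ∀ k, BoundedBy (fd (x k)) (K * (1 / 2) ^ k) ∧
      BoundedBy (fd (fd (x k))) (K * (1 / 4) ^ k) ∧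
      BoundedBy (fd (fd (fd (x k)))) (K * (3 / 16) ^ k) ∧
      BoundedBy (x (k + 1) - linearRule (x k)) (K * (1 / 4) ^ k) ∧
      BoundedBy (fd (x (k + 1) - linearRule (x k))) (K * (1 / 8) ^ k) := by
  have hC := h.nonneg_C
  obtain ⟨K, hK0, hK⟩ := h.decay_fd
  obtain ⟨L, hL0, hL⟩ := h.decay_fd_fd hK0 hK
  have hr : ∀ k, BoundedBy (x (k + 1) - linearRule (x k)) (C * K ^ 2 * (1 / 4) ^ k) := by
    intro k i
    refine (h.proximity k _ (h.bounded_fd k) (h.supNorm_fd_le k) i).trans ?_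
    have h1 : supNorm (fd (x k)) ^ 2 ≤ (K * (1 / 2) ^ k) ^ 2 :=
      pow_le_pow_left₀ (supNorm_nonneg _) (hK k) 2
    have h2 : (K * (1 / 2 : ℝ) ^ k) ^ 2 = K ^ 2 * (1 / 4) ^ k := by
      rw [mul_pow, ← pow_mul, mul_comm k 2, pow_mul]; norm_num
    rw [h2] at h1
    rw [mul_assoc]
    exact mul_le_mul_of_nonneg_left h1 hC
  set M := C * (K ^ 3 + K * L) with hM
  have hM0 : 0 ≤ M := by positivity
  have hfr : ∀ k, BoundedBy (fd (x (k + 1) - linearRule (x k))) (M * (1 / 8) ^ k) := by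
    intro k i
    refine (h.proximity_fd k _ _ (h.bounded_fd k) (h.supNorm_fd_le k) (h.bounded_fd_fd k) i).trans
      ?_
    have h1 : supNorm (fd (x k)) ^ 3 ≤ (K * (1 / 2) ^ k) ^ 3 :=
      pow_le_pow_left₀ (supNorm_nonneg _) (hK k) 3
    have h2 : (K * (1 / 2 : ℝ) ^ k) ^ 3 = K ^ 3 * (1 / 8) ^ k := by
      rw [mul_pow, ← pow_mul, mul_comm k 3, pow_mul]; norm_num
    have h3 : supNorm (fd (x k)) * supNorm (fd (fd (x k))) ≤
        (K * (1 / 2) ^ k) * (L * (1 / 4) ^ k) :=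
      mul_le_mul (hK k) (hL k) (supNorm_nonneg _) (by positivity)
    have h4 : (K * (1 / 2 : ℝ) ^ k) * (L * (1 / 4) ^ k) = K * L * (1 / 8) ^ k := by
      rw [mul_mul_mul_comm, ← mul_pow]; norm_num
    rw [h2] at h1
    rw [h4] at h3
    rw [hM, mul_assoc]
    refine mul_le_mul_of_nonneg_left ?_ hC
    linarith
  have hb3 : ∀ k, BoundedBy (fd (fd (fd (x k)))) (supNorm (fd (fd (fd (x k))))) :=
    fun k => (h.contract k).fd.fd.boundedBy_supNorm
  -- The scaling `4 ^ k`, not `8 ^ k`, is what continuity of the second derivative requires; two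
  -- further differences of the error cost only a factor 4.
  have hstep : ∀ k, 4 ^ (k + 1) * supNorm (fd (fd (fd (x (k + 1))))) ≤
      4 ^ k * supNorm (fd (fd (fd (x k)))) / 2 + 16 * M * (1 / 2) ^ k := by
    intro k
    have h1 := (hb3 k).fd_fd_fd_linearRule.add (hfr k).fd.fd
    rw [← fd_add, ← fd_add, ← fd_add, add_sub_cancel] at h1
    have h2 := mul_le_mul_of_nonneg_left h1.supNorm_le (by positivity : (0 : ℝ) ≤ 4 ^ (k + 1))
    have h3 : (4 : ℝ) ^ k * (1 / 8) ^ k = (1 / 2) ^ k := by rw [← mul_pow]; norm_num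
    have h4 : (4 : ℝ) ^ (k + 1) * (supNorm (fd (fd (fd (x k)))) / 8 + 2 * (2 * (M * (1 / 8) ^ k)))
        = 4 ^ k * supNorm (fd (fd (fd (x k)))) / 2 + 16 * M * (4 ^ k * (1 / 8) ^ k) := by ring
    rw [h4, h3] at h2
    exact h2
  have hthird := le_geometric_of_le_half_add (v := fun k => 4 ^ k * supNorm (fd (fd (fd (x k)))))
    (mul_nonneg (by positivity) (supNorm_nonneg _)) (by positivity) hstep
  set P := 4 ^ 0 * supNorm (fd (fd (fd (x 0)))) + 4 * (16 * M) with hP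
  have hP0 : 0 ≤ P := add_nonneg (mul_nonneg (by positivity) (supNorm_nonneg _)) (by positivity)
  have hCK : 0 ≤ C * K ^ 2 := by positivity
  refine ⟨K + L + P + C * K ^ 2 + M, by positivity, fun k => ⟨fun i => ?_, fun i => ?_, fun i => ?_,
    fun i => ?_, fun i => ?_⟩⟩
  · refine (h.bounded_fd k i).trans ((hK k).trans ?_)
    exact mul_le_mul_of_nonneg_right (by linarith) (by positivity)
  · refine (h.bounded_fd_fd k i).trans ((hL k).trans ?_)
    exact mul_le_mul_of_nonneg_right (by linarith) (by positivity)
  · have h1 : supNorm (fd (fd (fd (x k)))) ≤ P * (3 / 16) ^ k := by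
      have h2 := hthird k
      have h3 : (4 : ℝ) ^ k * (P * (3 / 16) ^ k) = P * (3 / 4) ^ k := by
        rw [mul_left_comm, ← mul_pow]; norm_num
      exact le_of_mul_le_mul_left (h2.trans h3.ge) (by positivity)
    refine (hb3 k i).trans (h1.trans ?_)
    exact mul_le_mul_of_nonneg_right (by linarith) (by positivity)
  · exact (hr k i).trans (mul_le_mul_of_nonneg_right (by linarith) (by positivity))
  · exact (hfr k i).trans (mul_le_mul_of_nonneg_right (by linarith) (by positivity))

end Decay

/-! ### Limits of coherent families of sequences -/

section Limit

variable {V : Type*} [NormedAddCommGroup V]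

/-- Geometrically coherent values on the grids `2⁻ᵏ ℤ`. -/
def Coherent (v : ℕ → ℤ → V) : Prop :=
  ∃ C : ℝ, ∀ k i, ‖fd (v k) i‖ ≤ C * (3 / 4) ^ k ∧
    ‖v (k + 1) (2 * i) - v k i‖ ≤ C * (3 / 4) ^ k ∧
    ‖v (k + 1) (2 * i + 1) - v k i‖ ≤ C * (3 / 4) ^ k

/-- `F` is the geometric limit of the grid functions `v k`. -/
def GridLimit (v : ℕ → ℤ → V) (F : ℝ → V) : Prop :=
  ∃ C : ℝ, ∀ k t, ‖v k ⌊2 ^ k * t⌋ - F t‖ ≤ C * (3 / 4) ^ k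

/-- Refining the grid moves the index `i` below `t` to `2i` or `2i + 1`, the two cases in
`Coherent`. -/
lemma floor_pow_succ_mul (k : ℕ) (t : ℝ) :
    ⌊2 ^ (k + 1) * t⌋ = 2 * ⌊2 ^ k * t⌋ ∨ ⌊2 ^ (k + 1) * t⌋ = 2 * ⌊2 ^ k * t⌋ + 1 := by
  have h1 := Int.floor_le (2 ^ k * t)
  have h2 := Int.lt_floor_add_one (2 ^ k * t)
  have h3 : (2 : ℝ) ^ (k + 1) * t = 2 * (2 ^ k * t) := by ring
  rw [h3]
  generalize (2 : ℝ) ^ k * t = s at *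
  rcases lt_or_ge (2 * s) (2 * ⌊s⌋ + 1) with h | h
  · left
    rw [Int.floor_eq_iff]
    push_cast
    constructor <;> linarith
  · right
    rw [Int.floor_eq_iff]
    push_cast
    constructor <;> linarith

lemma floor_mul_close {s t : ℝ} (h : t ≤ s) (h' : s ≤ t + 1) :
    ⌊s⌋ = ⌊t⌋ ∨ ⌊s⌋ = ⌊t⌋ + 1 := by
  have h1 := Int.floor_le_floor h
  have h2 := Int.floor_le_floor h'
  rw [Int.floor_add_one] at h2
  omega

lemma three_quarter_tendsto (C : ℝ) :
    Tendsto (fun k : ℕ => C * (3 / 4 : ℝ) ^ k) atTop (nhds 0) := by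
  simpa using (tendsto_pow_atTop_nhds_zero_of_lt_one (by norm_num : (0 : ℝ) ≤ 3 / 4)
    (by norm_num)).const_mul C

lemma GridLimit.tendsto {v : ℕ → ℤ → V} {F : ℝ → V} (h : GridLimit v F) (t : ℝ) :
    Tendsto (fun k => v k ⌊2 ^ k * t⌋) atTop (nhds (F t)) := by
  obtain ⟨C, hC⟩ := h
  rw [tendsto_iff_norm_sub_tendsto_zero]
  exact squeeze_zero (fun _ => norm_nonneg _) (fun k => hC k t) (three_quarter_tendsto C)

lemma Coherent.exists_gridLimit [CompleteSpace V] {v : ℕ → ℤ → V} (h : Coherent v) :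
    ∃ F, GridLimit v F := by
  obtain ⟨C, hC⟩ := h
  have hd : ∀ (t : ℝ) (k : ℕ), dist (v k ⌊2 ^ k * t⌋) (v (k + 1) ⌊2 ^ (k + 1) * t⌋) ≤ C * (3 / 4) ^ k := by
    intro t k
    rw [dist_comm, dist_eq_norm]
    rcases floor_pow_succ_mul k t with h | h <;> rw [h]
    · exact (hC k _).2.1
    · exact (hC k _).2.2
  have hc : ∀ t : ℝ, ∃ a, Tendsto (fun k => v k ⌊2 ^ k * t⌋) atTop (nhds a) := fun t =>
    cauchySeq_tendsto_of_complete (cauchySeq_of_le_geometric _ C (by norm_num) (hd t))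
  choose F hF using hc
  refine ⟨F, 4 * C, fun k t => ?_⟩
  have := dist_le_of_le_geometric_of_tendsto _ C (by norm_num) (hd t) (hF t) k
  rw [dist_eq_norm] at this
  refine this.trans (le_of_eq ?_)
  ring

lemma GridLimit.norm_next_le {v : ℕ → ℤ → V} {F : ℝ → V} (h : Coherent v) (hF : GridLimit v F) :
    ∃ C : ℝ, ∀ k t, ‖v k ⌊2 ^ k * t⌋ - F t‖ ≤ C * (3 / 4) ^ k ∧
      ‖v k (⌊2 ^ k * t⌋ + 1) - F t‖ ≤ C * (3 / 4) ^ k := by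
  obtain ⟨B, hB⟩ := h
  obtain ⟨C, hC⟩ := hF
  have hB0 : 0 ≤ B := by simpa using (norm_nonneg _).trans (hB 0 0).1
  refine ⟨B + C, fun k t => ⟨(hC k t).trans ?_, ?_⟩⟩
  · exact mul_le_mul_of_nonneg_right (by linarith) (by positivity)
  · have h1 := norm_sub_le_norm_sub_add_norm_sub (v k (⌊2 ^ k * t⌋ + 1)) (v k ⌊2 ^ k * t⌋) (F t)
    have h2 := (hB k ⌊2 ^ k * t⌋).1
    rw [fd] at h2
    linarith [hC k t]

/-- Parameters within one grid step have equal or adjacent indices, so `v k` compares their limits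
with error `O((3/4) ^ k)`. -/
lemma GridLimit.continuous {v : ℕ → ℤ → V} {F : ℝ → V} (h : Coherent v) (hF : GridLimit v F) :
    Continuous F := by
  obtain ⟨C, hC⟩ := hF.norm_next_le h
  have key : ∀ k s t, t ≤ s → s ≤ t + (2 ^ k)⁻¹ → ‖F s - F t‖ ≤ 2 * C * (3 / 4) ^ k := by
    intro k s t hts hst
    have hp : (0 : ℝ) < 2 ^ k := by positivity
    have h1 : (2 : ℝ) ^ k * s ≤ 2 ^ k * t + 1 := by
      have := mul_le_mul_of_nonneg_left hst hp.le
      rwa [mul_add, mul_inv_cancel₀ hp.ne'] at this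
    have h2 := (hC k s).1
    have h3 : ‖v k ⌊2 ^ k * s⌋ - F t‖ ≤ C * (3 / 4) ^ k := by
      rcases floor_mul_close (mul_le_mul_of_nonneg_left hts hp.le) h1 with h | h <;> rw [h]
      · exact (hC k t).1
      · exact (hC k t).2
    have h4 := norm_sub_le_norm_sub_add_norm_sub (F s) (v k ⌊2 ^ k * s⌋) (F t)
    rw [norm_sub_rev (F s) (v k _)] at h4
    linarith
  rw [Metric.continuous_iff]
  intro t ε hε
  obtain ⟨k, hk⟩ := ((three_quarter_tendsto (2 * C)).eventually_lt_const hε).exists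
  refine ⟨(2 ^ k)⁻¹, by positivity, fun s hs => ?_⟩
  rw [Real.dist_eq, abs_lt] at hs
  rw [dist_eq_norm]
  refine lt_of_le_of_lt ?_ hk
  rcases le_total t s with h | h
  · exact key k s t h (by linarith)
  · rw [norm_sub_rev]
    exact key k t s h (by linarith)

variable [NormedSpace ℝ V]

lemma norm_sub_sub_smul_le {v : ℤ → V} {g : V} {c : ℝ} {m n : ℤ} (hmn : m ≤ n)
    (h : ∀ i, m ≤ i → i < n → ‖fd v i - g‖ ≤ c) :
    ‖v n - v m - ((n : ℝ) - m) • g‖ ≤ ((n : ℝ) - m) * c := by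
  induction n, hmn using Int.leInduction with
  | base => simp
  | succ n hmn ih =>
    have h1 := ih fun i hi hi' => h i hi (by omega)
    have h2 := h n hmn (by omega)
    have h3 : v (n + 1) - v m - (((n + 1 : ℤ) : ℝ) - m) • g =
        (v n - v m - ((n : ℝ) - m) • g) + (fd v n - g) := by
      rw [fd]; push_cast; module
    rw [h3]
    refine (norm_add_le _ _).trans ((add_le_add h1 h2).trans (le_of_eq ?_))
    push_cast; ring

lemma tendsto_floor_div (t : ℝ) :
    Tendsto (fun k : ℕ => (⌊(2 : ℝ) ^ k * t⌋ : ℝ) / 2 ^ k) atTop (nhds t) := by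
  have h0 : Tendsto (fun k : ℕ => t - (1 / 2 : ℝ) ^ k) atTop (nhds t) := by
    simpa using (tendsto_pow_atTop_nhds_zero_of_lt_one (by norm_num : (0 : ℝ) ≤ 1 / 2)
      (by norm_num)).const_sub t
  refine tendsto_of_tendsto_of_tendsto_of_le_of_le h0 tendsto_const_nhds (fun k => ?_)
    (fun k => ?_)
  · have hp : (0 : ℝ) < 2 ^ k := by positivity
    have h1 := Int.lt_floor_add_one ((2 : ℝ) ^ k * t)
    show t - (1 / 2 : ℝ) ^ k ≤ _
    rw [le_div_iff₀ hp, sub_mul, ← mul_pow]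
    norm_num
    linarith
  · have hp : (0 : ℝ) < 2 ^ k := by positivity
    show _ ≤ t
    rw [div_le_iff₀ hp]
    linarith [Int.floor_le ((2 : ℝ) ^ k * t)]

/-- The limit of scaled differences is the derivative of the limit. -/
lemma GridLimit.hasDerivAt {v : ℕ → ℤ → V} {F G : ℝ → V} (hF : GridLimit v F)
    (hG : GridLimit (fun k i => (2 : ℝ) ^ k • fd (v k) i) G) (hGc : Continuous G) (a : ℝ) :
    HasDerivAt F (G a) a := by
  obtain ⟨C, hC⟩ := hG
  -- A mean value estimate: the differences between the grid indices of `b` and `c` are summed at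
  -- level `k`, then `k` tends to infinity.
  have key : ∀ ε > 0, ∃ δ > 0, ∀ b c, a - δ < b → b ≤ c → c < a + δ →
      ‖F c - F b - (c - b) • G a‖ ≤ (c - b) * ε := by
    intro ε hε
    obtain ⟨δ, hδ, hδG⟩ := Metric.continuous_iff.1 hGc a ε hε
    refine ⟨δ, hδ, fun b c hb hbc hc => ?_⟩
    have hlim1 : Tendsto (fun k : ℕ => ‖v k ⌊2 ^ k * c⌋ - v k ⌊2 ^ k * b⌋ -
        ((⌊(2 : ℝ) ^ k * c⌋ : ℝ) / 2 ^ k - (⌊(2 : ℝ) ^ k * b⌋ : ℝ) / 2 ^ k) • G a‖) atTop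
        (nhds ‖F c - F b - (c - b) • G a‖) :=
      (((hF.tendsto c).sub (hF.tendsto b)).sub
        (((tendsto_floor_div c).sub (tendsto_floor_div b)).smul_const _)).norm
    have hlim2 : Tendsto (fun k : ℕ =>
        ((⌊(2 : ℝ) ^ k * c⌋ : ℝ) / 2 ^ k - (⌊(2 : ℝ) ^ k * b⌋ : ℝ) / 2 ^ k) *
          (ε + C * (3 / 4) ^ k)) atTop (nhds ((c - b) * (ε + 0))) :=
      ((tendsto_floor_div c).sub (tendsto_floor_div b)).mul
        ((three_quarter_tendsto C).const_add ε)
    rw [add_zero] at hlim2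
    refine le_of_tendsto_of_tendsto hlim1 hlim2 ?_
    -- The grid point below `b` may lie left of `b`; the strict inequality `a - δ < b` leaves room
    -- for large `k`.
    have hbk : ∀ᶠ k : ℕ in atTop, a - δ < (⌊(2 : ℝ) ^ k * b⌋ : ℝ) / 2 ^ k :=
      (tendsto_floor_div b).eventually_const_lt hb
    filter_upwards [hbk] with k hk
    have hp : (0 : ℝ) < 2 ^ k := by positivity
    have hmn : ⌊(2 : ℝ) ^ k * b⌋ ≤ ⌊(2 : ℝ) ^ k * c⌋ :=
      Int.floor_le_floor (mul_le_mul_of_nonneg_left hbc hp.le)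
    have h := norm_sub_sub_smul_le (v := v k) (g := ((2 : ℝ) ^ k)⁻¹ • G a)
      (c := ((2 : ℝ) ^ k)⁻¹ * (ε + C * (3 / 4) ^ k)) hmn fun i hi hi' => by
        have h1 : fd (v k) i - ((2 : ℝ) ^ k)⁻¹ • G a =
            ((2 : ℝ) ^ k)⁻¹ • ((2 : ℝ) ^ k • fd (v k) i - G a) := by
          rw [smul_sub, smul_smul, inv_mul_cancel₀ hp.ne', one_smul]
        rw [h1, norm_smul, Real.norm_of_nonneg (by positivity)]
        refine mul_le_mul_of_nonneg_left ?_ (by positivity)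
        have h2 := hC k ((i : ℝ) / 2 ^ k)
        rw [mul_div_cancel₀ _ hp.ne', Int.floor_intCast] at h2
        have h3 : ‖G ((i : ℝ) / 2 ^ k) - G a‖ < ε := by
          rw [← dist_eq_norm]
          refine hδG _ ?_
          have h4 : (⌊(2 : ℝ) ^ k * b⌋ : ℝ) / 2 ^ k ≤ (i : ℝ) / 2 ^ k :=
            div_le_div_of_nonneg_right (by exact_mod_cast hi) hp.le
          have h5 : (i : ℝ) / 2 ^ k ≤ c := by
            rw [div_le_iff₀ hp, mul_comm]
            exact (Int.cast_le.2 hi'.le).trans (Int.floor_le _)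
          rw [Real.dist_eq, abs_lt]
          constructor <;> linarith
        have h4 := norm_sub_le_norm_sub_add_norm_sub ((2 : ℝ) ^ k • fd (v k) i)
          (G ((i : ℝ) / 2 ^ k)) (G a)
        linarith
    rw [smul_smul, ← mul_assoc, ← div_eq_mul_inv, sub_div] at h
    exact h
  rw [hasDerivAt_iff_isLittleO, Asymptotics.isLittleO_iff]
  intro ε hε
  obtain ⟨δ, hδ, hkey⟩ := key ε hε
  filter_upwards [Metric.ball_mem_nhds a hδ] with t ht
  rw [Metric.mem_ball, Real.dist_eq, abs_lt] at ht
  rcases le_total a t with h | h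
  · rw [Real.norm_of_nonneg (by linarith), mul_comm]
    exact hkey a t (by linarith) h (by linarith)
  · rw [norm_sub_rev t a, Real.norm_of_nonneg (by linarith), mul_comm]
    have h1 := hkey t a (by linarith) h (by linarith)
    have h2 : F t - F a - (t - a) • G a = -(F a - F t - (a - t) • G a) := by module
    rwa [h2, norm_neg]

/-! ### Scaled differences of a nearly linear refinement -/

variable {x : ℕ → ℤ → V} {A μ C : ℝ}

lemma pow_mul_pow_le {a b K : ℝ} (ha : 0 ≤ a) (hb : 0 ≤ b) (hab : a * b ≤ 3 / 4) (hK : 0 ≤ K)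
    (k : ℕ) : a ^ k * (K * b ^ k) ≤ K * (3 / 4) ^ k := by
  rw [mul_left_comm, ← mul_pow]
  exact mul_le_mul_of_nonneg_left (pow_le_pow_left₀ (mul_nonneg ha hb) hab k) hK

/-- Under the linear rule a scaled difference is passed on unchanged up to a multiple of the next
higher difference. Those terms and the perturbations decay at least like `(3/4) ^ k` by
`NearLinear.decay`; the slowest is `4 * 3/16 = 3/4`. -/
lemma NearLinear.coherent (h : NearLinear x A μ C) :
    Coherent x ∧ Coherent (fun k i => (2 : ℝ) ^ k • fd (x k) i) ∧
      Coherent (fun k i => (4 : ℝ) ^ k • fd (fd (x k)) i) := by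
  obtain ⟨K, hK0, hK⟩ := h.decay
  have hq : ∀ {a b : ℝ} (k : ℕ), 0 ≤ a → 0 ≤ b → a * b ≤ 3 / 4 →
      a ^ k * (K * b ^ k) ≤ K * (3 / 4) ^ k := fun k ha hb hab => pow_mul_pow_le ha hb hab hK0 k
  have hsplit : ∀ k, x (k + 1) = linearRule (x k) + (x (k + 1) - linearRule (x k)) := fun k => by
    abel
  have hsplit1 : ∀ k, fd (x (k + 1)) =
      fd (linearRule (x k)) + fd (x (k + 1) - linearRule (x k)) := fun k => by
    rw [← fd_add, ← hsplit]
  have hsplit2 : ∀ k, fd (fd (x (k + 1))) =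
      fd (fd (linearRule (x k))) + fd (fd (x (k + 1) - linearRule (x k))) := fun k => by
    rw [← fd_add, ← hsplit1]
  have hnonneg : ∀ k : ℕ, 0 ≤ K * (3 / 4) ^ k := fun k => by positivity
  refine ⟨⟨2 * K, fun k i => ?_⟩, ⟨4 * K, fun k i => ?_⟩, ⟨20 * K, fun k i => ?_⟩⟩
  · obtain ⟨h1, -, -, h4, -⟩ := hK k
    have q1 := hq (a := 1) (b := 1 / 2) k (by norm_num) (by norm_num) (by norm_num)
    have q2 := hq (a := 1) (b := 1 / 4) k (by norm_num) (by norm_num) (by norm_num)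
    rw [one_pow, one_mul] at q1 q2
    refine ⟨(h1 i).trans (by linarith [hnonneg k]), ?_, ?_⟩
    · have e : x (k + 1) (2 * i) - x k i = (1 / 8 : ℝ) • fd (x k) i +
          (1 / 8 : ℝ) • (-fd (x k) (i - 1)) + (x (k + 1) - linearRule (x k)) (2 * i) := by
        rw [Pi.sub_apply, linearRule_even, fd_pred, fd]; module
      rw [e]
      have := norm_combination_le (a := 1 / 8) (b := 1 / 8) (by norm_num) (by norm_num) (h1 i)
        (by rw [norm_neg]; exact h1 (i - 1))
      refine (norm_add_le _ _).trans ?_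
      linarith [h4 (2 * i), hnonneg k]
    · have e : x (k + 1) (2 * i + 1) - x k i = (1 / 2 : ℝ) • fd (x k) i +
          (x (k + 1) - linearRule (x k)) (2 * i + 1) := by
        rw [Pi.sub_apply, linearRule_odd, fd]; module
      rw [e]
      refine (norm_add_le _ _).trans ?_
      rw [norm_smul, Real.norm_of_nonneg (by norm_num)]
      linarith [h4 (2 * i + 1), h1 i, hnonneg k]
  · obtain ⟨-, h2, -, -, h5⟩ := hK k
    have hp : (0 : ℝ) < 2 ^ k := by positivity
    have q1 := hq (a := 2) (b := 1 / 4) k (by norm_num) (by norm_num) (by norm_num)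
    have q2 := hq (a := 2) (b := 1 / 8) k (by norm_num) (by norm_num) (by norm_num)
    have h2' : ∀ i, 2 ^ k * ‖fd (fd (x k)) i‖ ≤ K * (3 / 4) ^ k := fun i =>
      (mul_le_mul_of_nonneg_left (h2 i) hp.le).trans q1
    have h5' : ∀ i, 2 ^ k * ‖fd (x (k + 1) - linearRule (x k)) i‖ ≤ K * (3 / 4) ^ k := fun i =>
      (mul_le_mul_of_nonneg_left (h5 i) hp.le).trans q2
    refine ⟨?_, ?_, ?_⟩
    · have e : fd (fun i => (2 : ℝ) ^ k • fd (x k) i) i = (2 : ℝ) ^ k • fd (fd (x k)) i := by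
        simp only [fd, smul_sub]
      rw [e, norm_smul, Real.norm_of_nonneg hp.le]
      linarith [h2' i, hnonneg k]
    · have e : (2 : ℝ) ^ (k + 1) • fd (x (k + 1)) (2 * i) - (2 : ℝ) ^ k • fd (x k) i =
          (2 : ℝ) ^ k • ((-(1 / 4) : ℝ) • fd (fd (x k)) (i - 1) +
            (2 : ℝ) • fd (x (k + 1) - linearRule (x k)) (2 * i)) := by
        rw [hsplit1, Pi.add_apply, fd_linearRule_even, fd_pred (fd (x k)), pow_succ]
        module
      rw [e, norm_smul, Real.norm_of_nonneg hp.le]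
      have h6 := norm_add_le ((-(1 / 4) : ℝ) • fd (fd (x k)) (i - 1))
        ((2 : ℝ) • fd (x (k + 1) - linearRule (x k)) (2 * i))
      rw [norm_smul, norm_smul, norm_neg, Real.norm_of_nonneg (by norm_num),
        Real.norm_of_nonneg (by norm_num)] at h6
      have h7 := mul_le_mul_of_nonneg_left h6 hp.le
      linarith [h2' (i - 1), h5' (2 * i), hnonneg k]
    · have e : (2 : ℝ) ^ (k + 1) • fd (x (k + 1)) (2 * i + 1) - (2 : ℝ) ^ k • fd (x k) i =
          (2 : ℝ) ^ k • ((1 / 4 : ℝ) • fd (fd (x k)) i +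
            (2 : ℝ) • fd (x (k + 1) - linearRule (x k)) (2 * i + 1)) := by
        have : fd (fd (x k)) i = fd (x k) (i + 1) - fd (x k) i := rfl
        rw [hsplit1, Pi.add_apply, fd_linearRule_odd, this, pow_succ]
        module
      rw [e, norm_smul, Real.norm_of_nonneg hp.le]
      have h6 := norm_add_le ((1 / 4 : ℝ) • fd (fd (x k)) i)
        ((2 : ℝ) • fd (x (k + 1) - linearRule (x k)) (2 * i + 1))
      rw [norm_smul, norm_smul, Real.norm_of_nonneg (by norm_num),
        Real.norm_of_nonneg (by norm_num)] at h6
      have h7 := mul_le_mul_of_nonneg_left h6 hp.le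
      linarith [h2' i, h5' (2 * i + 1), hnonneg k]
  · obtain ⟨-, -, h3, -, h5⟩ := hK k
    have hp : (0 : ℝ) < 4 ^ k := by positivity
    have q1 := hq (a := 4) (b := 3 / 16) k (by norm_num) (by norm_num) (by norm_num)
    have q2 := hq (a := 4) (b := 1 / 8) k (by norm_num) (by norm_num) (by norm_num)
    have h3' : ∀ i, 4 ^ k * ‖fd (fd (fd (x k))) i‖ ≤ K * (3 / 4) ^ k := fun i =>
      (mul_le_mul_of_nonneg_left (h3 i) hp.le).trans q1
    have h5' : ∀ i, 4 ^ k * ‖fd (fd (x (k + 1) - linearRule (x k))) i‖ ≤ 2 * (K * (3 / 4) ^ k) :=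
      fun i => by
        have h6 := mul_le_mul_of_nonneg_left (BoundedBy.fd h5 i) hp.le
        linarith
    refine ⟨?_, ?_, ?_⟩
    · have e : fd (fun i => (4 : ℝ) ^ k • fd (fd (x k)) i) i =
          (4 : ℝ) ^ k • fd (fd (fd (x k))) i := by
        simp only [fd, smul_sub]
      rw [e, norm_smul, Real.norm_of_nonneg hp.le]
      linarith [h3' i, hnonneg k]
    · have e : (4 : ℝ) ^ (k + 1) • fd (fd (x (k + 1))) (2 * i) - (4 : ℝ) ^ k • fd (fd (x k)) i =
          (4 : ℝ) ^ k • ((-(1 / 2) : ℝ) • fd (fd (fd (x k))) (i - 1) +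
            (4 : ℝ) • fd (fd (x (k + 1) - linearRule (x k))) (2 * i)) := by
        rw [hsplit2, Pi.add_apply, fd_fd_linearRule_even, fd_pred (fd (fd (x k))), pow_succ]
        module
      rw [e, norm_smul, Real.norm_of_nonneg hp.le]
      have h6 := norm_add_le ((-(1 / 2) : ℝ) • fd (fd (fd (x k))) (i - 1))
        ((4 : ℝ) • fd (fd (x (k + 1) - linearRule (x k))) (2 * i))
      rw [norm_smul, norm_smul, norm_neg, Real.norm_of_nonneg (by norm_num),
        Real.norm_of_nonneg (by norm_num)] at h6
      have h7 := mul_le_mul_of_nonneg_left h6 hp.le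
      linarith [h3' (i - 1), h5' (2 * i), hnonneg k]
    · have e : (4 : ℝ) ^ (k + 1) • fd (fd (x (k + 1))) (2 * i + 1) -
          (4 : ℝ) ^ k • fd (fd (x k)) i =
          (4 : ℝ) ^ k • (4 : ℝ) • fd (fd (x (k + 1) - linearRule (x k))) (2 * i + 1) := by
        rw [hsplit2, Pi.add_apply, fd_fd_linearRule_odd, pow_succ]
        module
      rw [e, norm_smul, norm_smul, Real.norm_of_nonneg hp.le, Real.norm_of_nonneg (by norm_num)]
      linarith [h5' (2 * i + 1), hnonneg k]

lemma NearLinear.exists_contDiff_limit [CompleteSpace V] (h : NearLinear x A μ C) :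
    ∃ F : ℝ → V, ContDiff ℝ 2 F ∧ GridLimit x F := by
  obtain ⟨h0, h1, h2⟩ := h.coherent
  obtain ⟨F, hF⟩ := h0.exists_gridLimit
  obtain ⟨G, hG⟩ := h1.exists_gridLimit
  obtain ⟨H, hH⟩ := h2.exists_gridLimit
  have hGc := hG.continuous h1
  have hHc := hH.continuous h2
  have hF' := hF.hasDerivAt hG hGc
  have hH' : GridLimit (fun k i => (2 : ℝ) ^ k • fd (fun i => (2 : ℝ) ^ k • fd (x k) i) i) H := by
    have : (fun (k : ℕ) (i : ℤ) => (2 : ℝ) ^ k • fd (fun i => (2 : ℝ) ^ k • fd (x k) i) i) =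
        fun k i => (4 : ℝ) ^ k • fd (fd (x k)) i := by
      funext k i
      have e : fd (fun i => (2 : ℝ) ^ k • fd (x k) i) i = (2 : ℝ) ^ k • fd (fd (x k)) i := by
        simp only [fd, smul_sub]
      rw [e, smul_smul, ← mul_pow]
      norm_num
    rwa [this]
  have hG' := hG.hasDerivAt hH' hHc
  refine ⟨F, ?_, hF⟩
  have hdF : deriv F = G := funext fun t => (hF' t).deriv
  have hdG : deriv G = H := funext fun t => (hG' t).deriv
  rw [show (2 : WithTop ℕ∞) = 1 + 1 by norm_num, contDiff_succ_iff_deriv]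
  refine ⟨fun t => (hF' t).differentiableAt, by simp, ?_⟩
  rw [hdF, contDiff_one_iff_deriv, hdG]
  exact ⟨fun t => (hG' t).differentiableAt, hHc⟩

end Limit

/-! ### Convergence in charts -/

lemma norm_interpolant_sub_le {V : Type*} [NormedAddCommGroup V] [NormedSpace ℝ V] {k : ℕ}
    {v : ℤ → V} {t ε : ℝ} {w : V} (h0 : ‖v ⌊2 ^ k * t⌋ - w‖ ≤ ε)
    (h1 : ‖v (⌊2 ^ k * t⌋ + 1) - w‖ ≤ ε) : ‖interpolant k v t - w‖ ≤ ε := by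
  have hf0 := Int.fract_nonneg (2 ^ k * t)
  have hf1 := (Int.fract_lt_one (2 ^ k * t)).le
  have e : interpolant k v t - w = (1 - Int.fract (2 ^ k * t)) • (v ⌊2 ^ k * t⌋ - w) +
      Int.fract (2 ^ k * t) • (v (⌊2 ^ k * t⌋ + 1) - w) := by
    rw [interpolant]; module
  rw [e]
  refine (norm_combination_le (by linarith) hf0 h0 h1).trans (le_of_eq ?_)
  ring

/-- A chart is uniformly continuous on a compact ball inside its domain, and the interpolant is a
convex combination of two chart values near that of `F t`. -/
lemma convergesTo_of_dist_le {n : ℕ} {y : ℕ → ℤ → Sphere n} {F : ℝ → Sphere n}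
    (hF : Continuous F) {C : ℝ}
    (h : ∀ k t, dist (y k ⌊2 ^ k * t⌋) (F t) ≤ C * (3 / 4) ^ k ∧
      dist (y k (⌊2 ^ k * t⌋ + 1)) (F t) ≤ C * (3 / 4) ^ k) :
    ConvergesTo y F := by
  refine ⟨hF, fun t₀ φ _ ht₀ => ?_⟩
  obtain ⟨r, hr, hball⟩ := Metric.isOpen_iff.1 φ.open_source (F t₀) ht₀
  have hK : Metric.closedBall (F t₀) (r / 2) ⊆ φ.source :=
    (Metric.closedBall_subset_ball (by linarith)).trans hball
  have huc : UniformContinuousOn φ (Metric.closedBall (F t₀) (r / 2)) :=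
    (isCompact_closedBall _ _).uniformContinuousOn_of_continuous (φ.continuousOn.mono hK)
  obtain ⟨d, hd, hdF⟩ := Metric.continuous_iff.1 hF t₀ (r / 4) (by linarith)
  have hFt : ∀ t ∈ Set.Icc (t₀ - d / 2) (t₀ + d / 2), dist (F t) (F t₀) ≤ r / 4 := by
    intro t ht
    refine (hdF t ?_).le
    rw [Real.dist_eq, abs_lt]
    constructor <;> linarith [ht.1, ht.2]
  have hmem : ∀ {p : Sphere n} {t : ℝ}, t ∈ Set.Icc (t₀ - d / 2) (t₀ + d / 2) →
      dist p (F t) < r / 4 → p ∈ Metric.closedBall (F t₀) (r / 2) := by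
    intro p t ht hp
    rw [Metric.mem_closedBall]
    linarith [dist_triangle p (F t) (F t₀), hFt t ht]
  have hlim : ∀ ε > 0, ∀ᶠ k : ℕ in atTop, C * (3 / 4) ^ k < ε := fun ε hε =>
    (three_quarter_tendsto C).eventually_lt_const hε
  refine ⟨d / 2, by linarith, ?_, ?_⟩
  · filter_upwards [hlim (r / 4) (by linarith)] with k hk t ht
    refine ⟨hK (hmem ht (by rw [dist_self]; linarith)), hK (hmem ht ((h k t).1.trans_lt hk)),
      hK (hmem ht ((h k t).2.trans_lt hk))⟩
  · rw [Metric.tendstoUniformlyOn_iff]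
    intro ε hε
    obtain ⟨η, hη, hηφ⟩ := Metric.uniformContinuousOn_iff.1 huc (ε / 2) (by linarith)
    filter_upwards [hlim (r / 4) (by linarith), hlim η hη] with k hk hk' t ht
    have hFm : F t ∈ Metric.closedBall (F t₀) (r / 2) := hmem ht (by rw [dist_self]; linarith)
    have h1 := hηφ _ (hmem ht ((h k t).1.trans_lt hk)) _ hFm ((h k t).1.trans_lt hk')
    have h2 := hηφ _ (hmem ht ((h k t).2.trans_lt hk)) _ hFm ((h k t).2.trans_lt hk')
    rw [dist_eq_norm] at h1 h2
    rw [dist_comm, dist_eq_norm]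
    have h3 := norm_interpolant_sub_le (v := fun i => φ (y k i)) h1.le h2.le
    linarith

/-! ### The refined sequences follow the linear rule -/

section Sphere

variable {n : ℕ} {x : ℤ → Sphere n}

/-- The sequence `x` in the ambient space. -/
def ambient (x : ℤ → Sphere n) (i : ℤ) : EuclideanSpace ℝ (Fin (n + 1)) := x i

lemma norm_ambient (x : ℤ → Sphere n) (i : ℤ) : ‖ambient x i‖ = 1 := norm_coe_sphere _

lemma boundedBy_fd_ambient (x : ℤ → Sphere n) : BoundedBy (fd (ambient x)) (maxStep x) := by
  intro i
  rw [fd, norm_sub_rev]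
  exact (norm_sub_le_arccos (norm_ambient x i) (norm_ambient x (i + 1))).trans
    (geoDist_le_maxStep x i)

/-- The leading term of the deviation of the refined sequence from the linear rule. -/
noncomputable def deviation (x : ℤ → Sphere n) (i : ℤ) : EuclideanSpace ℝ (Fin (n + 1)) :=
  (‖fd (ambient x) i‖ ^ 2 / 8) • ambient x i

variable {D ε : ℝ}

lemma norm_deviation_le (hD : BoundedBy (fd (ambient x)) D) (i : ℤ) :
    ‖deviation x i‖ ≤ D ^ 2 / 8 := by
  rw [deviation, norm_smul, norm_ambient, mul_one, Real.norm_of_nonneg (by positivity)]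
  linarith [pow_le_pow_left₀ (norm_nonneg _) (hD i) 2]

/-- Product rule: differencing the factor `‖fd‖ ^ 2 / 8` produces a second difference times `D`,
differencing the point a third power of `D`. -/
lemma norm_fd_deviation_le (hD : BoundedBy (fd (ambient x)) D)
    (hε : BoundedBy (fd (fd (ambient x))) ε) (i : ℤ) :
    ‖fd (deviation x) i‖ ≤ D ^ 3 + D * ε := by
  have e : fd (deviation x) i =
      (‖fd (ambient x) (i + 1)‖ ^ 2 / 8 - ‖fd (ambient x) i‖ ^ 2 / 8) • ambient x (i + 1) +
        (‖fd (ambient x) i‖ ^ 2 / 8) • fd (ambient x) i := by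
    have : fd (ambient x) i = ambient x (i + 1) - ambient x i := rfl
    rw [fd, deviation, deviation]
    generalize ‖fd (ambient x) (i + 1)‖ ^ 2 / 8 = a
    generalize ‖fd (ambient x) i‖ ^ 2 / 8 = b
    rw [this]
    module
  rw [e]
  refine (norm_add_le _ _).trans ?_
  rw [norm_smul, norm_smul, norm_ambient, mul_one, Real.norm_eq_abs,
    Real.norm_of_nonneg (by positivity : 0 ≤ ‖fd (ambient x) i‖ ^ 2 / 8)]
  have h1 := abs_norm_sub_norm_le (fd (ambient x) (i + 1)) (fd (ambient x) i)
  have h2 : |‖fd (ambient x) (i + 1)‖ - ‖fd (ambient x) i‖| ≤ ε := h1.trans (hε i)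
  have h3 := hD i
  have h4 := hD (i + 1)
  have h5 := norm_nonneg (fd (ambient x) i)
  have h6 := norm_nonneg (fd (ambient x) (i + 1))
  generalize ‖fd (ambient x) (i + 1)‖ = a at *
  generalize ‖fd (ambient x) i‖ = b at *
  have hD0 : 0 ≤ D := h5.trans h3
  have h7 : |a ^ 2 / 8 - b ^ 2 / 8| ≤ D * ε := by
    have : a ^ 2 / 8 - b ^ 2 / 8 = (a + b) / 8 * (a - b) := by ring
    rw [this, abs_mul, abs_of_nonneg (by positivity)]
    exact mul_le_mul (by linarith) h2 (abs_nonneg _) hD0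
  have h8 : b ^ 2 / 8 * b ≤ D ^ 3 := by
    have := pow_le_pow_left₀ h5 h3 3
    have h9 : 0 ≤ b ^ 3 := by positivity
    linarith
  linarith

lemma norm_refined_sub_even_le (hx : maxStep x < 0.6) (hD : BoundedBy (fd (ambient x)) D)
    (hD1 : D ≤ 0.6) (hε : BoundedBy (fd (fd (ambient x))) ε) (i : ℤ) :
    ‖(ambient (refined x) - linearRule (ambient x)) (2 * i) - deviation x i‖ ≤
      15 * D ^ 3 + D * ε := by
  rw [Pi.sub_apply, linearRule_even]
  refine even_proximity (norm_ambient x (i - 1)) (norm_ambient x i) (norm_ambient x (i + 1))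
    (norm_ambient _ _) hD1 ?_ (hD i) ?_ (isCenter_refine hx (2 * i)).le_of_even
  · rw [← fd_pred]
    exact hD (i - 1)
  · have := hε (i - 1)
    rw [fd_pred, fd_pred, fd] at this
    refine le_trans (le_of_eq ?_) this
    congr 1
    module

lemma norm_refined_sub_odd_le (hx : maxStep x < 0.6) (hD : BoundedBy (fd (ambient x)) D)
    (hD1 : D ≤ 0.6) (i : ℤ) :
    ‖(ambient (refined x) - linearRule (ambient x)) (2 * i + 1) - deviation x i‖ ≤ D ^ 3 := by
  rw [Pi.sub_apply, linearRule_odd, ambient, coe_refine_odd hx]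
  exact odd_proximity (norm_ambient x i) (norm_ambient x (i + 1)) (hD i) hD1

lemma boundedBy_refined_sub (hx : maxStep x < 0.6) (hD : BoundedBy (fd (ambient x)) D)
    (hD1 : D ≤ 0.6) :
    BoundedBy (ambient (refined x) - linearRule (ambient x)) (17 * D ^ 2) := by
  have hD0 : 0 ≤ D := (norm_nonneg _).trans (hD 0)
  have h3 : D ^ 3 ≤ 0.6 * D ^ 2 := by
    have := mul_le_mul_of_nonneg_right hD1 (sq_nonneg D)
    linarith
  have hsq := sq_nonneg D
  intro j
  obtain ⟨i, rfl | rfl⟩ := Int.even_or_odd' j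
  · have h1 := norm_refined_sub_even_le hx hD hD1 hD.fd i
    have h2 := norm_le_norm_sub_add ((ambient (refined x) - linearRule (ambient x)) (2 * i))
      (deviation x i)
    linarith [norm_deviation_le hD i]
  · have h1 := norm_refined_sub_odd_le hx hD hD1 i
    have h2 := norm_le_norm_sub_add ((ambient (refined x) - linearRule (ambient x)) (2 * i + 1))
      (deviation x i)
    linarith [norm_deviation_le hD i]

lemma boundedBy_fd_refined_sub (hx : maxStep x < 0.6) (hD : BoundedBy (fd (ambient x)) D)
    (hD1 : D ≤ 0.6) (hε : BoundedBy (fd (fd (ambient x))) ε) :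
    BoundedBy (fd (ambient (refined x) - linearRule (ambient x))) (17 * (D ^ 3 + D * ε)) := by
  have hD0 : 0 ≤ D := (norm_nonneg _).trans (hD 0)
  have hDε : 0 ≤ D * ε := mul_nonneg hD0 ((norm_nonneg _).trans (hε 0))
  have hD3 : 0 ≤ D ^ 3 := by positivity
  intro j
  obtain ⟨i, rfl | rfl⟩ := Int.even_or_odd' j
  -- From `2i` to `2i + 1` the leading terms are identical and cancel.
  · have h1 := norm_refined_sub_even_le hx hD hD1 hε i
    have h2 := norm_refined_sub_odd_le hx hD hD1 i
    have h3 := norm_sub_le_norm_sub_add_norm_sub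
      ((ambient (refined x) - linearRule (ambient x)) (2 * i + 1)) (deviation x i)
      ((ambient (refined x) - linearRule (ambient x)) (2 * i))
    rw [norm_sub_rev (deviation x i)] at h3
    rw [fd]
    linarith
  -- From `2i + 1` to `2i + 2` the leading terms differ by `fd (deviation x) i`.
  · have h1 := norm_refined_sub_even_le hx hD hD1 hε (i + 1)
    have h2 := norm_refined_sub_odd_le hx hD hD1 i
    have h3 := norm_fd_deviation_le hD hε i
    rw [fd, show 2 * i + 1 + 1 = 2 * (i + 1) by ring]
    have e : (ambient (refined x) - linearRule (ambient x)) (2 * (i + 1)) -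
        (ambient (refined x) - linearRule (ambient x)) (2 * i + 1) =
        ((ambient (refined x) - linearRule (ambient x)) (2 * (i + 1)) - deviation x (i + 1)) +
        (fd (deviation x) i -
          ((ambient (refined x) - linearRule (ambient x)) (2 * i + 1) - deviation x i)) := by
      rw [fd]; abel
    rw [e]
    have h4 := (norm_add_le _ _).trans (add_le_add h1 ((norm_sub_le _ _).trans (add_le_add h3 h2)))
    refine h4.trans ?_
    linarith

lemma nearLinear_iterate (hx : maxStep x < 0.6) :
    NearLinear (fun k => ambient (refined^[k] x)) 0.6 0.95 17 where
  nonneg_A := by norm_num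
  nonneg_C := by norm_num
  nonneg_μ := by norm_num
  lt_one := by norm_num
  contract k i := by
    refine (boundedBy_fd_ambient _ i).trans ((maxStep_iterate_le hx k).trans ?_)
    rw [mul_comm]
    exact mul_le_mul_of_nonneg_right hx.le (by positivity)
  proximity k D hD hD1 := by
    simp only [Function.iterate_succ_apply']
    exact boundedBy_refined_sub (maxStep_iterate_lt hx k) hD hD1
  proximity_fd k D ε hD hD1 hε := by
    simp only [Function.iterate_succ_apply']
    exact boundedBy_fd_refined_sub (maxStep_iterate_lt hx k) hD hD1 hε

lemma exists_smooth_limit (hx : maxStep x < 0.6) :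
    ∃ F : ℝ → Sphere n, ConvergesTo (fun k => refined^[k] x) F ∧
      ContMDiff 𝓘(ℝ, ℝ) (𝓡 n) 2 F := by
  have := Fact.mk (finrank_euclideanSpace_fin (𝕜 := ℝ) (n := n + 1))
  obtain ⟨f, hf, hlim⟩ := (nearLinear_iterate hx).exists_contDiff_limit
  obtain ⟨C, hC⟩ := hlim.norm_next_le (nearLinear_iterate hx).coherent.1
  -- The limit is built in the ambient space; it stays on the sphere because all approximants have
  -- norm one.
  have hmem : ∀ t, f t ∈ Metric.sphere (0 : EuclideanSpace ℝ (Fin (n + 1))) 1 := fun t => by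
    rw [mem_sphere_zero_iff_norm]
    refine tendsto_nhds_unique (hlim.tendsto t).norm ?_
    simp only [norm_ambient]
    exact tendsto_const_nhds
  refine ⟨Set.codRestrict f _ hmem, convergesTo_of_dist_le (hf.continuous.codRestrict hmem)
    (C := C) fun k t => ?_, ContMDiff.codRestrict_sphere hf.contMDiff hmem⟩
  simp only [Subtype.dist_eq, dist_eq_norm, Set.val_codRestrict_apply]
  exact hC k t

end Sphere

end SphereSubdivision

theorem mainTheorem1 :
    ∃ μ ∈ Set.Ioo (0 : ℝ) 1, ∃ C > (0 : ℝ), ∀ n : ℕ, 2 ≤ n →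
      ∀ x : ℤ → SphereSubdivision.Sphere n, SphereSubdivision.maxStep x < 0.6 →
        SphereSubdivision.WellDefinedFor SphereSubdivision.cubicLaneRiesenfeldMask x ∧
        SphereSubdivision.ContractiveFor SphereSubdivision.cubicLaneRiesenfeldMask μ x ∧
        SphereSubdivision.DisplacementSafeFor SphereSubdivision.cubicLaneRiesenfeldMask C x ∧
        ∃ F : ℝ → SphereSubdivision.Sphere n,
          SphereSubdivision.ConvergesTo
            (fun k => (SphereSubdivision.riemannianAnalogue
              SphereSubdivision.cubicLaneRiesenfeldMask)^[k] x) F ∧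
          ContMDiff 𝓘(ℝ, ℝ) (𝓡 n) 2 F :=
  ⟨0.95, by norm_num, 0.45, by norm_num, fun _ _ _ hx =>
    ⟨SphereSubdivision.wellDefinedFor hx, SphereSubdivision.contractiveFor hx,
      SphereSubdivision.displacementSafeFor hx, SphereSubdivision.exists_smooth_limit hx⟩⟩
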